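/- Let $G$ be a finite group, $p$ a prime and $k$ a field of characteristic $p$. All $kG$-modules are finitely generated, and complexes are $\mathbb{Z}$-graded chain complexes of such modules; $\simeq$ denotes homotopy equivalence of complexes of $kG$-modules. A $kG$-module is a $p$-permutation module if its restriction to every $p$-subgroup $P$ of $G$ is a permutation module, i.e. has a $k$-basis permuted by $P$. For a subgroup $P\le G$ and a $kG$-module $M$, the Brauer construction is the $k[N_G(P)/P]$-module $M(P)=M^P/\sum_{Q<P}\operatorname{tr}_Q^P(M^Q)$, where $\operatorname{tr}_Q^P(m)=\sum_{x\in[P/Q]}x\cdot m$; for a complex $C$, $C(P)$ is obtained by applying this functor degreewise. A $kG$-module is $H$-projective, for $H\le G$, if it is a direct summand of $\operatorname{Ind}_H^G N$ for some $kH$-module $N$. For a set $\mathcal X$ of subgroups of $G$, a $kG$-module is $\mathcal X$-projective if each of its indecomposable direct summands is $H$-projective for some $H\in\mathcal X$. **Theorem.** Let $C$ be a bounded chain complex of $p$-permutation $kG$-modules, and let $\mathcal X$ be a nonempty set of $p$-subgroups of $G$ which is closed under $G$-conjugation and under taking subgroups. The following are equivalent: (a) $C(P)$ is acyclic for every $p$-subgroup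 $P$ of $G$ with $P\notin\mathcal X$. (b) There is a chain complex $D$ of $kG$-modules with $C\simeq D$ such that $D_i$ is $\mathcal X$-projective for all $i\in\mathbb Z$. (b$'$) There is a complex $D$ as in (b) which is moreover a bounded complex of $p$-permutation modules. In particular (the case $\mathcal X=\{1\}$, Bouc's theorem), the following are equivalent: $C(P)$ is acyclic for every nontrivial $p$-subgroup $P$ of $G$; $C$ is homotopy equivalent to a chain complex of projective $kG$-modules; $C$ is homotopy equivalent to a bounded chain complex of projective $kG$-modules. -/

import Mathlib

open CategoryTheory CategoryTheory.Limits

universe u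

namespace BoucGeneralization

section Brauer

variable {k G : Type u} [Field k] [Group G]

/-- The subspace `M^H` of `H`-fixed points of a `kG`-module `M`. -/
noncomputable abbrev fixedPoints (M : Rep.{u} k G) (H : Subgroup G) : Submodule k M :=
  Representation.invariants (M.ρ.comp H.subtype)

theorem apply_of_mem (M : Rep.{u} k G) {H : Subgroup G} {g : G} (hg : g ∈ H)
    (m : fixedPoints M H) : M.ρ g m = m := m.2 ⟨g, hg⟩

/-- For `m ∈ M^Q`, the map `P / Q → M`, `xQ ↦ x • m`. -/
noncomputable def translate (M : Rep.{u} k G) (P Q : Subgroup G) (m : fixedPoints M Q) :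
    (P ⧸ Q.subgroupOf P) → M :=
  Quotient.lift (fun x : P => M.ρ (x : G) m) (by
    intro a b hab
    have h : (a : G)⁻¹ * b ∈ Q := by
      have := QuotientGroup.leftRel_apply.mp hab
      simpa [Subgroup.mem_subgroupOf] using this
    have h2 := apply_of_mem M h m
    change M.ρ (a : G) m = M.ρ (b : G) m
    conv_lhs => rw [← h2]
    rw [← Module.End.mul_apply, ← map_mul, mul_inv_cancel_left])

theorem translate_mk (M : Rep.{u} k G) (P Q : Subgroup G) (m : fixedPoints M Q) (x : P) :
    translate M P Q m (x : P ⧸ Q.subgroupOf P) = M.ρ (x : G) m := rfl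

theorem conj_mem {P : Subgroup G} (g : Subgroup.normalizer (P : Set G)) {x : G} (hx : x ∈ P) :
    (g : G)⁻¹ * x * g ∈ P :=
  (Subgroup.mem_normalizer_iff''.mp g.2 x).mp hx

/-- The action of `N_G(P)` on `M^P`. -/
noncomputable def normalizerRep (M : Rep.{u} k G) (P : Subgroup G) :
    Representation k (Subgroup.normalizer (P : Set G)) (fixedPoints M P) where
  toFun g := (M.ρ (g : G)).restrict (p := fixedPoints M P) (q := fixedPoints M P) (by
    intro m hm x
    have h := hm ⟨_, conj_mem g x.2⟩
    change M.ρ (x : G) (M.ρ (g : G) m) = M.ρ (g : G) m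
    change M.ρ ((g : G)⁻¹ * x * g) m = m at h
    conv_rhs => rw [← h]
    simp only [← Module.End.mul_apply, ← map_mul]
    congr 2
    group)
  map_one' := by
    ext m
    change M.ρ ((1 : Subgroup.normalizer (P : Set G)) : G) m = m
    simp
  map_mul' g h := by
    ext m
    change M.ρ ((g : G) * h) m = M.ρ (g : G) (M.ρ (h : G) m)
    simp

variable [Finite G]

/-- The trace map `tr_Q^P : M^Q → M^P`, `m ↦ ∑_{x ∈ [P/Q]} x • m`. -/
noncomputable def relTrace (M : Rep.{u} k G) (P Q : Subgroup G) :
    fixedPoints M Q →ₗ[k] fixedPoints M P where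
  toFun m := ⟨∑ᶠ x : P ⧸ Q.subgroupOf P, translate M P Q m x, by
    intro g
    change M.ρ (g : G) _ = _
    rw [map_finsum (M.ρ (g : G)) (Set.toFinite _)]
    refine finsum_eq_of_bijective (fun x => g • x) (MulAction.bijective g) ?_
    intro x
    induction x using QuotientGroup.induction_on with
    | H x =>
      change M.ρ (g : G) (M.ρ (x : G) m) = M.ρ ((g * x : P) : G) m
      simp⟩
  map_add' a b := by
    ext
    change ∑ᶠ _, _ = ∑ᶠ _, _ + ∑ᶠ _, _
    rw [← finsum_add_distrib (Set.toFinite _) (Set.toFinite _)]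
    refine finsum_congr fun x => ?_
    induction x using QuotientGroup.induction_on with
    | H x => simp [translate_mk]
  map_smul' c a := by
    ext
    change ∑ᶠ _, _ = c • ∑ᶠ _, _
    rw [smul_finsum]
    refine finsum_congr fun x => ?_
    induction x using QuotientGroup.induction_on with
    | H x => simp [translate_mk]

theorem relTrace_coe (M : Rep.{u} k G) (P Q : Subgroup G) (m : fixedPoints M Q) :
    (relTrace M P Q m : M) = ∑ᶠ x : P ⧸ Q.subgroupOf P, translate M P Q m x := rfl

/-- The subspace `∑_{Q < P} tr_Q^P(M^Q)` of `M^P`. -/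
noncomputable def traceSum (M : Rep.{u} k G) (P : Subgroup G) :
    Submodule k (fixedPoints M P) :=
  ⨆ (Q : Subgroup G) (_ : Q < P), LinearMap.range (relTrace M P Q)

/-- `g • tr_Q^P(m) = tr_{gQg⁻¹}^P(g • m)` for `g ∈ N_G(P)`. -/
theorem normalizerRep_relTrace (M : Rep.{u} k G) (P Q : Subgroup G)
    (g : Subgroup.normalizer (P : Set G)) (m : fixedPoints M Q)
    (m' : fixedPoints M (Q.map (MulAut.conj (g : G)).toMonoidHom))
    (hm : (m' : M) = M.ρ (g : G) m) :
    normalizerRep M P g (relTrace M P Q m) =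
      relTrace M P (Q.map (MulAut.conj (g : G)).toMonoidHom) m' := by
  have hP : ∀ x : P, (g : G) * x * (g : G)⁻¹ ∈ P := fun x =>
    (Subgroup.mem_normalizer_iff.mp g.2 x).mp x.2
  have key : ∀ a b : P, (QuotientGroup.leftRel (Q.subgroupOf P)) a b ↔
      (QuotientGroup.leftRel ((Q.map (MulAut.conj (g : G)).toMonoidHom).subgroupOf P))
        (⟨_, hP a⟩ : P) ⟨_, hP b⟩ := by
    intro a b
    rw [QuotientGroup.leftRel_apply, QuotientGroup.leftRel_apply, Subgroup.mem_subgroupOf,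
      Subgroup.mem_subgroupOf, Subgroup.mem_map_equiv]
    simp [mul_assoc]
  ext
  change M.ρ (g : G) (∑ᶠ x, translate M P Q m x) = ∑ᶠ x, translate M P _ m' x
  rw [map_finsum (M.ρ (g : G)) (Set.toFinite _)]
  refine finsum_eq_of_bijective
    (Quotient.map (fun x : P => (⟨_, hP x⟩ : P)) fun a b h => (key a b).mp h) ⟨?_, ?_⟩ ?_
  · intro x y
    refine Quotient.inductionOn₂ x y fun a b h => ?_
    exact Quotient.sound ((key a b).mpr (Quotient.exact h))
  · intro y
    refine Quotient.inductionOn y fun b => ?_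
    refine ⟨Quotient.mk _ ⟨_, conj_mem g b.2⟩, ?_⟩
    refine congrArg (Quotient.mk _) (Subtype.ext ?_)
    simp [mul_assoc]
  · intro x
    refine Quotient.inductionOn x fun a => ?_
    change M.ρ (g : G) (M.ρ (a : G) m) = M.ρ ((g : G) * a * (g : G)⁻¹) m'
    rw [hm]
    simp only [← Module.End.mul_apply, ← map_mul]
    simp

theorem traceSum_le_comap (M : Rep.{u} k G) (P : Subgroup G)
    (g : Subgroup.normalizer (P : Set G)) :
    traceSum M P ≤ (traceSum M P).comap (normalizerRep M P g) := by
  refine iSup₂_le fun Q hQ => ?_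
  rintro _ ⟨m, rfl⟩
  have hm : M.ρ (g : G) m ∈ fixedPoints M (Q.map (MulAut.conj (g : G)).toMonoidHom) := by
    rintro ⟨_, x, hx, rfl⟩
    change M.ρ ((g : G) * x * (g : G)⁻¹) (M.ρ (g : G) m) = M.ρ (g : G) m
    conv_rhs => rw [← apply_of_mem M hx m]
    simp only [← Module.End.mul_apply, ← map_mul]
    simp
  rw [Submodule.mem_comap, normalizerRep_relTrace M P Q g m ⟨_, hm⟩ rfl]
  have hlt : Q.map (MulAut.conj (g : G)).toMonoidHom < P := by
    have h : P.map (MulAut.conj (g : G)).toMonoidHom = P :=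
      Subgroup.mem_normalizer_iff_map_conj_eq.mp g.2
    conv_rhs => rw [← h]
    exact (Subgroup.map_lt_map_iff_of_injective (MulAut.conj (g : G)).injective).mpr hQ
  exact Submodule.mem_iSup_of_mem _ (Submodule.mem_iSup_of_mem hlt ⟨_, rfl⟩)

/-- The action of `N_G(P)` on the Brauer quotient `M^P / ∑_{Q < P} tr_Q^P(M^Q)`. -/
noncomputable abbrev brauerRep (M : Rep.{u} k G) (P : Subgroup G) :
    Representation k (Subgroup.normalizer (P : Set G)) (fixedPoints M P ⧸ traceSum M P) :=
  (normalizerRep M P).quotient (traceSum M P) (traceSum_le_comap M P)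

instance brauerRep_isTrivial (M : Rep.{u} k G) (P : Subgroup G) :
    Representation.IsTrivial ((brauerRep M P).comp
      (P.subgroupOf (Subgroup.normalizer (P : Set G))).subtype) where
  out x := by
    ext m
    change Submodule.Quotient.mk _ = Submodule.Quotient.mk _
    exact congrArg _ (Subtype.ext (apply_of_mem M (Subgroup.mem_subgroupOf.mp x.2) m))

/-- The Brauer construction `M(P) = M^P / ∑_{Q < P} tr_Q^P(M^Q)`, a `k[N_G(P)/P]`-module. -/
noncomputable abbrev brauerQuotient (M : Rep.{u} k G) (P : Subgroup G) :
    Rep.{u} k (Subgroup.normalizer (P : Set G) ⧸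
      P.subgroupOf (Subgroup.normalizer (P : Set G))) :=
  Rep.of ((brauerRep M P).ofQuotient (P.subgroupOf (Subgroup.normalizer (P : Set G))))

/-- The map `M^H → N^H` induced by a homomorphism `f : M → N`. -/
noncomputable def fixedPointsMap {M N : Rep.{u} k G} (f : M ⟶ N) (H : Subgroup G) :
    fixedPoints M H →ₗ[k] fixedPoints N H :=
  f.hom.toLinearMap.restrict (p := fixedPoints M H) (q := fixedPoints N H) fun m hm x => by
    have h := Rep.hom_comm_apply f (x : G) m
    exact h.symm.trans (congrArg f.hom (hm x))

theorem traceSum_le_comap_map {M N : Rep.{u} k G} (f : M ⟶ N) (P : Subgroup G) :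
    traceSum M P ≤ (traceSum N P).comap (fixedPointsMap f P) := by
  refine iSup₂_le fun Q hQ => ?_
  rintro _ ⟨m, rfl⟩
  have h : fixedPointsMap f P (relTrace M P Q m) = relTrace N P Q (fixedPointsMap f Q m) := by
    ext
    change f.hom.toLinearMap (∑ᶠ x, translate M P Q m x) = ∑ᶠ x, translate N P Q _ x
    rw [map_finsum f.hom.toLinearMap (Set.toFinite _)]
    refine finsum_congr fun x => ?_
    induction x using QuotientGroup.induction_on with
    | H x => exact Rep.hom_comm_apply f (x : G) m
  rw [Submodule.mem_comap, h]
  exact Submodule.mem_iSup_of_mem _ (Submodule.mem_iSup_of_mem hQ ⟨_, rfl⟩)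

variable (k) in
/-- The Brauer construction as a functor from `kG`-modules to `k[N_G(P)/P]`-modules. -/
noncomputable def brauerFunctor (P : Subgroup G) :
    Rep.{u} k G ⥤ Rep.{u} k (Subgroup.normalizer (P : Set G) ⧸
      P.subgroupOf (Subgroup.normalizer (P : Set G))) where
  obj M := brauerQuotient M P
  map {M N} f := Rep.ofHom ⟨Submodule.mapQ _ _ (fixedPointsMap f P) (traceSum_le_comap_map f P), by
    intro g
    induction g using QuotientGroup.induction_on with
    | H g =>
      refine LinearMap.ext fun m => ?_
      obtain ⟨m, rfl⟩ := Submodule.Quotient.mk_surjective _ m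
      change Submodule.Quotient.mk _ = Submodule.Quotient.mk _
      exact congrArg _ (Subtype.ext (Rep.hom_comm_apply f (g : G) m))⟩
  map_id M := by
    ext m
    rfl
  map_comp f g := by
    ext m
    rfl

instance brauerFunctor_additive (P : Subgroup G) : (brauerFunctor k P).Additive where
  map_add {M N f g} := by
    ext m
    obtain ⟨m, rfl⟩ := Submodule.Quotient.mk_surjective _ m
    rfl

/-- The complex `C(P)` obtained by applying the Brauer construction degreewise. -/
noncomputable abbrev brauerComplex (C : ChainComplex (Rep.{u} k G) ℤ) (P : Subgroup G) :
    ChainComplex (Rep.{u} k (Subgroup.normalizer (P : Set G) ⧸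
      P.subgroupOf (Subgroup.normalizer (P : Set G)))) ℤ :=
  ((brauerFunctor k P).mapHomologicalComplex _).obj C

end Brauer

section Modules

variable {k G : Type u} [Field k] [Group G]

/-- `M` is a (finitely generated) permutation module: it has a finite `k`-basis which is
permuted by the group. -/
def IsPermutation (M : Rep.{u} k G) : Prop :=
  ∃ (n : ℕ) (b : Module.Basis (Fin n) k M), ∀ (g : G) (i : Fin n), ∃ j : Fin n, M.ρ g (b i) = b j

/-- `M` is a (finitely generated) `p`-permutation module: its restriction to every `p`-subgroup
is a permutation module. -/
def IsPPermutation (p : ℕ) (M : Rep.{u} k G) : Prop :=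
  ∀ P : Subgroup G, IsPGroup p P → IsPermutation (Rep.res P.subtype M)

/-- `N` is isomorphic to a direct summand of `M`. -/
def IsDirectSummand (N M : Rep.{u} k G) : Prop :=
  ∃ N' : Rep.{u} k G, Nonempty (M ≅ N ⊞ N')

/-- `M` is relatively `H`-projective: it is a direct summand of `Ind_H^G N` for some finitely
generated `kH`-module `N`. -/
def IsRelProjective (H : Subgroup G) (M : Rep.{u} k G) : Prop :=
  ∃ N : Rep.{u} k H, Module.Finite k N ∧ IsDirectSummand M (Rep.ind H.subtype N)

/-- `M` is `X`-projective: every indecomposable direct summand of `M` is relatively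
`H`-projective for some `H ∈ X`. To be used for finitely generated `M` only. -/
def IsSetProjective (X : Set (Subgroup G)) (M : Rep.{u} k G) : Prop :=
  ∀ N : Rep.{u} k G, Indecomposable N → IsDirectSummand N M → ∃ H ∈ X, IsRelProjective H N

/-- The complex `C` has only finitely many nonzero terms. -/
def IsBounded (C : ChainComplex (Rep.{u} k G) ℤ) : Prop :=
  ∃ a b : ℤ, ∀ i : ℤ, i < a ∨ b < i → IsZero (C.X i)

end Modules

end BoucGeneralization

/-! By Higman's criterion, a finitely generated module is $\mathcal X$-projective exactly when its
identity is a sum of traces $\operatorname{tr}_H^G(\varphi_H)$ with $H\in\mathcal X$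
(`isSetProjective_iff`); Fitting's lemma supplies the passage through indecomposable summands. Such
traces form an ideal under composition. Restricted to a subgroup $P$ lying in no conjugate of a
member of $\mathcal X$, they become sums of proper traces, so $M(P)=0$; this gives (b) ⇒ (a), since
$C(P)\simeq D(P)$.

For (a) ⇒ (b'), replace $C$ by a complex $D$ of least total dimension among the bounded
$p$-permutation complexes homotopy equivalent to it. Fitting's lemma for complexes makes every
endomorphism of $D$ homotopic to the identity invertible (`exists_minimal_complex`). It requires
retracts of $p$-permutation modules to be $p$-permutation modules again
(`HasFrame.hasPermutedBasis`).

All terms of $D$ are projective relative to the family of all $p$-subgroups. Classes are now removed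
(`isTraceProjective_of_exactAt`). Let $P\notin\mathcal X$ be maximal in the current family $\mathcal
Y$, let $\mathcal Y'$ be $\mathcal Y$ without the class of $P$, and let $n$ be the least degree
where $D_n$ fails to be $\mathcal Y'$-projective. Then $D_{n-1}(P)=0$, so $D_{n+1}(P)\to D_n(P)$ is
onto. As $D_n$ is a permutation module over $P$, there is a $P$-map $s$ with $1-ds=t$ a sum of
proper traces. Writing $1=\operatorname{tr}_P^G(\varphi)+j$ with $j$ a $\mathcal Y'$-trace, the map
$h=\operatorname{tr}_P^G(s\varphi)$ satisfies $1-dh=\operatorname{tr}_P^G(t\varphi)+j$, again a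
$\mathcal Y'$-trace. It is the degree $n$ part of an endomorphism homotopic to the identity, hence
invertible, and the ideal property makes $D_n$ $\mathcal Y'$-projective, a contradiction. -/

namespace BoucGeneralization

/-! ### Relative traces: transitivity, conjugation, restriction to a subgroup. -/

section Traces

variable {k G : Type u} [Field k] [Group G]

/-- The map on `H`-fixed points induced by an `H`-equivariant linear map. -/
noncomputable def fixedMap {V W : Rep.{u} k G} (f : V →ₗ[k] W) (H : Subgroup G)
    (hf : ∀ g ∈ H, ∀ v, f (V.ρ g v) = W.ρ g (f v)) : fixedPoints V H →ₗ[k] fixedPoints W H :=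
  f.restrict (p := fixedPoints V H) (q := fixedPoints W H) fun m hm x => by
    have h := hf x x.2 m
    exact h.symm.trans (congrArg f (hm x))

theorem fixedPoints_anti (V : Rep.{u} k G) {H K : Subgroup G} (h : H ≤ K) :
    fixedPoints V K ≤ fixedPoints V H :=
  fun _ hv x => hv ⟨x, h x.2⟩

theorem apply_mem_fixedPoints_conj (V : Rep.{u} k G) (H : Subgroup G) (g : G)
    (v : fixedPoints V H) : V.ρ g v ∈ fixedPoints V (H.map (MulAut.conj g).toMonoidHom) := by
  rintro ⟨_, x, hx, rfl⟩
  change V.ρ (g * x * g⁻¹) (V.ρ g v) = V.ρ g v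
  conv_rhs => rw [← apply_of_mem V hx v]
  simp only [← Module.End.mul_apply, ← map_mul]
  simp

variable [Finite G]

theorem fixedMap_relTrace {V W : Rep.{u} k G} (f : V →ₗ[k] W) {P Q : Subgroup G} (hQ : Q ≤ P)
    (hf : ∀ g ∈ P, ∀ v, f (V.ρ g v) = W.ρ g (f v)) (v : fixedPoints V Q) :
    fixedMap f P hf (relTrace V P Q v) =
      relTrace W P Q (fixedMap f Q (fun g hg => hf g (hQ hg)) v) := by
  ext
  change f (∑ᶠ x, translate V P Q v x) = ∑ᶠ x, translate W P Q _ x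
  rw [map_finsum f (Set.toFinite _)]
  refine finsum_congr fun x => ?_
  induction x using QuotientGroup.induction_on with
  | H x => exact hf x x.2 v

/-- The subspace `∑_{Q ∈ Y} tr_Q^P(V^Q)` of `V^P`. -/
noncomputable def traceSpan (V : Rep.{u} k G) (P : Subgroup G) (Y : Set (Subgroup G)) :
    Submodule k (fixedPoints V P) :=
  ⨆ (Q : Subgroup G) (_ : Q ∈ Y), LinearMap.range (relTrace V P Q)

theorem traceSum_eq_traceSpan (V : Rep.{u} k G) (P : Subgroup G) :
    traceSum V P = traceSpan V P {Q | Q < P} := rfl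

theorem relTrace_mem_traceSpan (V : Rep.{u} k G) (P : Subgroup G) {Y : Set (Subgroup G)}
    {Q : Subgroup G} (hQ : Q ∈ Y) (v : fixedPoints V Q) : relTrace V P Q v ∈ traceSpan V P Y :=
  Submodule.mem_iSup_of_mem _ (Submodule.mem_iSup_of_mem hQ ⟨_, rfl⟩)

theorem traceSpan_mono (V : Rep.{u} k G) (P : Subgroup G) {Y Z : Set (Subgroup G)} (h : Y ⊆ Z) :
    traceSpan V P Y ≤ traceSpan V P Z :=
  biSup_mono h

theorem fixedMap_mem_traceSpan {V W : Rep.{u} k G} (f : V →ₗ[k] W) {P : Subgroup G}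
    {Y : Set (Subgroup G)} (hY : ∀ Q ∈ Y, Q ≤ P)
    (hf : ∀ g ∈ P, ∀ v, f (V.ρ g v) = W.ρ g (f v)) {v : fixedPoints V P}
    (hv : v ∈ traceSpan V P Y) : fixedMap f P hf v ∈ traceSpan W P Y := by
  suffices h : traceSpan V P Y ≤ (traceSpan W P Y).comap (fixedMap f P hf) from h hv
  refine iSup₂_le fun Q hQ => ?_
  rintro _ ⟨m, rfl⟩
  rw [Submodule.mem_comap, fixedMap_relTrace f (hY Q hQ)]
  exact relTrace_mem_traceSpan _ _ hQ _

/-- Transitivity of traces. -/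
theorem relTrace_trans (V : Rep.{u} k G) {Q P R : Subgroup G} (hQP : Q ≤ P) (hPR : P ≤ R)
    (v : fixedPoints V Q) : relTrace V R P (relTrace V P Q v) = relTrace V R Q v := by
  classical
  have := Fintype.ofFinite G
  have hle : Q.subgroupOf R ≤ P.subgroupOf R := fun x hx => hQP hx
  ext
  simp only [relTrace_coe]
  have := Fintype.ofFinite (R ⧸ P.subgroupOf R)
  have := Fintype.ofFinite (R ⧸ Q.subgroupOf R)
  have := Fintype.ofFinite (P ⧸ Q.subgroupOf P)
  -- Sum over the fibres of $R/Q\to R/P$; the fibre over $xP$ is $x\cdot(P/Q)$.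
  let r : R ⧸ Q.subgroupOf R → R ⧸ P.subgroupOf R := Quotient.map id fun a b h =>
    QuotientGroup.leftRel_apply.mpr (hle (QuotientGroup.leftRel_apply.mp h))
  rw [finsum_eq_sum_of_fintype, finsum_eq_sum_of_fintype, ← Finset.sum_fiberwise_of_maps_to
    (s := Finset.univ) (t := Finset.univ) (g := r) (fun _ _ => Finset.mem_univ _)]
  refine Finset.sum_congr rfl fun x _ => ?_
  induction x using QuotientGroup.induction_on with
  | H x =>
    rw [translate_mk, relTrace_coe, map_finsum (V.ρ (x : G)) (Set.toFinite _),
      finsum_eq_sum_of_fintype]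
    let e : P ⧸ Q.subgroupOf P → R ⧸ Q.subgroupOf R :=
      Quotient.map (fun y : P => x * ⟨y, hPR y.2⟩) fun a b h => by
        rw [← Quotient.eq_iff_equiv] at *
        refine QuotientGroup.eq.mpr ?_
        have := QuotientGroup.eq.mp h
        simpa [Subgroup.mem_subgroupOf, mul_assoc] using this
    refine Finset.sum_bij (fun y _ => e y) ?_ ?_ ?_ ?_
    · intro y _
      induction y using QuotientGroup.induction_on with
      | H y =>
        simp only [Finset.mem_filter, Finset.mem_univ, true_and]
        refine QuotientGroup.eq.mpr ?_
        simp [Subgroup.mem_subgroupOf]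
    · intro y _ z _ h
      induction y using QuotientGroup.induction_on with
      | H y =>
        induction z using QuotientGroup.induction_on with
        | H z =>
          refine QuotientGroup.eq.mpr ?_
          have := QuotientGroup.eq.mp h
          simpa [Subgroup.mem_subgroupOf, mul_assoc] using this
    · intro z hz
      induction z using QuotientGroup.induction_on with
      | H z =>
        simp only [Finset.mem_filter, Finset.mem_univ, true_and] at hz
        have hz' : z⁻¹ * x ∈ P.subgroupOf R := QuotientGroup.leftRel_apply.mp (Quotient.exact hz)
        refine ⟨QuotientGroup.mk ⟨(x : G)⁻¹ * z, by
          simpa [Subgroup.mem_subgroupOf] using P.inv_mem hz'⟩,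
          Finset.mem_univ _, ?_⟩
        refine congrArg (QuotientGroup.mk (s := Q.subgroupOf R)) (Subtype.ext ?_)
        simp
    · intro y _
      induction y using QuotientGroup.induction_on with
      | H y =>
        change V.ρ (x : G) (V.ρ (y : G) v) = V.ρ ((x : G) * y) v
        simp

theorem relTrace_mem_of_mem_traceSpan (V : Rep.{u} k G) {P R : Subgroup G} (hPR : P ≤ R)
    {Y Z : Set (Subgroup G)} (hY : ∀ Q ∈ Y, Q ≤ P) (hZ : Y ⊆ Z) {v : fixedPoints V P}
    (hv : v ∈ traceSpan V P Y) : relTrace V R P v ∈ traceSpan V R Z := by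
  suffices h : traceSpan V P Y ≤ (traceSpan V R Z).comap (relTrace V R P) from h hv
  refine iSup₂_le fun Q hQ => ?_
  rintro _ ⟨m, rfl⟩
  rw [Submodule.mem_comap, relTrace_trans V (hY Q hQ) hPR]
  exact relTrace_mem_traceSpan _ _ (hZ hQ) _

/-- The whole group normalizes itself, and $g$ acts trivially on the $G$-fixed vector
$\operatorname{tr}_H^G(v)$. -/
theorem relTrace_conj (V : Rep.{u} k G) (H : Subgroup G) (g : G) (v : fixedPoints V H)
    (v' : fixedPoints V (H.map (MulAut.conj g).toMonoidHom)) (hv : (v' : V) = V.ρ g v) :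
    relTrace V ⊤ (H.map (MulAut.conj g).toMonoidHom) v' = relTrace V ⊤ H v := by
  have hg : g ∈ Subgroup.normalizer ((⊤ : Subgroup G) : Set G) := by
    rw [Subgroup.mem_normalizer_iff]; simp
  rw [← normalizerRep_relTrace V ⊤ H ⟨g, hg⟩ v v' hv]
  exact Subtype.ext (apply_of_mem V (H := ⊤) (Subgroup.mem_top g) _)

/-- A trace from a conjugate of `H` is a trace from `H`. -/
theorem exists_relTrace_eq_of_conj (V : Rep.{u} k G) (H : Subgroup G) (g : G)
    (v : fixedPoints V (H.map (MulAut.conj g).toMonoidHom)) :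
    ∃ w : fixedPoints V H, relTrace V ⊤ H w =
      relTrace V ⊤ (H.map (MulAut.conj g).toMonoidHom) v := by
  have h := apply_mem_fixedPoints_conj V _ g⁻¹ v
  have hH : (H.map (MulAut.conj g).toMonoidHom).map (MulAut.conj g⁻¹).toMonoidHom = H := by
    rw [Subgroup.map_map]
    convert Subgroup.map_id H
    ext x
    simp [mul_assoc]
  rw [hH] at h
  refine ⟨⟨V.ρ g⁻¹ v, h⟩, ?_⟩
  refine (relTrace_conj V H g _ v ?_).symm
  simp

/-- A sum over an equivariant family without `P`-fixed indices is a sum of proper traces. -/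
theorem finsum_mem_traceSum (V : Rep.{u} k G) (P : Subgroup G) {Ω : Type*} [Finite Ω]
    [MulAction P Ω] (φ : Ω → V) (hφ : ∀ (g : P) (ω : Ω), φ (g • ω) = V.ρ (g : G) (φ ω))
    (hΩ : ∀ ω : Ω, ∃ g : P, g • ω ≠ ω) :
    ∃ t ∈ traceSum V P, (t : V) = ∑ᶠ ω, φ ω := by
  classical
  let S (ω : Ω) : Subgroup G := (MulAction.stabilizer P ω).map P.subtype
  have hS (ω : Ω) : (S ω).subgroupOf P = MulAction.stabilizer P ω :=
    Subgroup.comap_map_eq_self_of_injective P.subtype_injective _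
  have hSP (ω : Ω) : S ω < P := by
    refine lt_of_le_of_ne (Subgroup.map_subtype_le _) fun h => ?_
    obtain ⟨g, hg⟩ := hΩ ω
    refine hg ?_
    have : (g : G) ∈ S ω := by rw [h]; exact g.2
    obtain ⟨x, hx, hxg⟩ := this
    rw [Subtype.ext hxg] at hx
    exact hx
  have hfix (ω : Ω) : φ ω ∈ fixedPoints V (S ω) := by
    rintro ⟨_, x, hx, rfl⟩
    exact (hφ x ω).symm.trans (congrArg φ hx)
  -- The sum over one orbit is the trace from the stabilizer of a representative, a proper subgroup
  -- by `hΩ`.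
  let t (o : MulAction.orbitRel.Quotient P Ω) : fixedPoints V P :=
    relTrace V P (S o.out) ⟨φ o.out, hfix _⟩
  have := Fintype.ofFinite Ω
  have := Fintype.ofFinite (MulAction.orbitRel.Quotient P Ω)
  have (ω : Ω) : Finite (P ⧸ MulAction.stabilizer P ω) := inferInstance
  have (ω : Ω) : Fintype (P ⧸ MulAction.stabilizer P ω) := Fintype.ofFinite _
  refine ⟨∑ o, t o, Submodule.sum_mem _ fun o _ => relTrace_mem_traceSpan V P (hSP _) _, ?_⟩
  rw [finsum_eq_sum_of_fintype, Submodule.coe_sum,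
    ← (MulAction.selfEquivSigmaOrbitsQuotientStabilizer P Ω).symm.sum_comp, Fintype.sum_sigma]
  refine Finset.sum_congr rfl fun o _ => ?_
  have hq : ∀ a b : P, QuotientGroup.leftRel ((S o.out).subgroupOf P) a b ↔
      QuotientGroup.leftRel (MulAction.stabilizer P o.out) a b := fun a b => by rw [hS]
  rw [relTrace_coe, ← finsum_eq_sum_of_fintype]
  refine finsum_eq_of_bijective (Quotient.congr (Equiv.refl P) hq) (Equiv.bijective _) ?_
  intro x
  induction x using QuotientGroup.induction_on with
  | H x =>
    rw [translate_mk]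
    refine (hφ x o.out).symm.trans (congrArg φ ?_)
    rfl

/-- If no conjugate of a member of `Y` contains `P`, a sum of traces from `Y` to `G` is a sum of
proper traces to `P`. -/
theorem mem_traceSum_of_mem_traceSpan_top (V : Rep.{u} k G) {P : Subgroup G}
    {Y : Set (Subgroup G)} (hY : ∀ H ∈ Y, ∀ g : G, ¬ P ≤ H.map (MulAut.conj g).toMonoidHom)
    {v : fixedPoints V ⊤} (hv : v ∈ traceSpan V ⊤ Y) :
    (⟨v, fixedPoints_anti V le_top v.2⟩ : fixedPoints V P) ∈ traceSum V P := by
  suffices h : traceSpan V ⊤ Y ≤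
      (traceSum V P).comap (Submodule.inclusion (fixedPoints_anti V (le_top : P ≤ ⊤))) from h hv
  refine iSup₂_le fun H hH => ?_
  rintro _ ⟨m, rfl⟩
  -- A coset $xH$ fixed by $P$ would give $P\le xHx^{-1}$. Hence $P$ has no fixed point on $G/H$,
  -- and no double coset formula is needed.
  let : MulAction P ((⊤ : Subgroup G) ⧸ H.subgroupOf ⊤) :=
    MulAction.compHom _ (Subgroup.inclusion (le_top : P ≤ ⊤))
  obtain ⟨t, ht, hte⟩ := finsum_mem_traceSum V P (translate V ⊤ H m) (fun g ω => by
    induction ω using QuotientGroup.induction_on with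
    | H x =>
      change V.ρ ((g : G) * x) m = V.ρ (g : G) (V.ρ (x : G) m)
      simp) (fun ω => by
    induction ω using QuotientGroup.induction_on with
    | H x =>
      by_contra! hc
      refine hY H hH x fun p hp => ?_
      have h1 : ((⟨p, trivial⟩ * x : (⊤ : Subgroup G)) : (⊤ : Subgroup G) ⧸ H.subgroupOf ⊤) = x :=
        hc ⟨p, hp⟩
      have h2 := QuotientGroup.eq.mp h1.symm
      rw [Subgroup.mem_subgroupOf] at h2
      refine ⟨_, h2, ?_⟩
      simp [mul_assoc])
  rw [Submodule.mem_comap]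
  convert ht
  exact Subtype.ext hte.symm

end Traces

/-! ### Traces on $\operatorname{Hom}_k(M,N)$ and projectivity relative to a set of subgroups. -/

section HomTraces

variable {k G : Type u} [Field k] [Group G]

/-- The `kG`-module `Hom_k(M, N)`. -/
noncomputable abbrev homRep (M N : Rep.{u} k G) : Rep.{u} k G :=
  Rep.of (Representation.linHom M.ρ N.ρ)

theorem mem_fixedPoints_homRep {M N : Rep.{u} k G} {H : Subgroup G} {f : M →ₗ[k] N} :
    f ∈ fixedPoints (homRep M N) H ↔ ∀ g ∈ H, ∀ m, f (M.ρ g m) = N.ρ g (f m) := by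
  constructor
  · intro h g hg m
    have h1 : N.ρ g ∘ₗ f ∘ₗ M.ρ g⁻¹ = f := h ⟨g, hg⟩
    conv_lhs => rw [← h1]
    simp
  · rintro h ⟨g, hg⟩
    change N.ρ g ∘ₗ f ∘ₗ M.ρ g⁻¹ = f
    ext m
    simp [← h g hg]

/-- A fixed point of `Hom_k(M, N)` as a homomorphism. -/
noncomputable def homOfFixed {M N : Rep.{u} k G} (f : fixedPoints (homRep M N) ⊤) : M ⟶ N :=
  Rep.ofHom ⟨(f : M →ₗ[k] N), fun g => LinearMap.ext fun m =>
    mem_fixedPoints_homRep.mp f.2 g trivial m⟩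

theorem postcomp_equivariant (L : Rep.{u} k G) {M N : Rep.{u} k G} {P : Subgroup G} (f : M →ₗ[k] N)
    (hf : ∀ g ∈ P, ∀ m, f (M.ρ g m) = N.ρ g (f m)) :
    ∀ g ∈ P, ∀ φ : homRep L M, (LinearMap.compRight k (M := L) f) ((homRep L M).ρ g φ) =
      (homRep L N).ρ g (LinearMap.compRight k (M := L) f φ) := by
  intro g hg φ
  refine LinearMap.ext fun m => ?_
  exact hf g hg _

theorem precomp_equivariant (L : Rep.{u} k G) {M N : Rep.{u} k G} {P : Subgroup G} (f : M →ₗ[k] N)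
    (hf : ∀ g ∈ P, ∀ m, f (M.ρ g m) = N.ρ g (f m)) :
    ∀ g ∈ P, ∀ φ : homRep N L, (LinearMap.lcomp k L f) ((homRep N L).ρ g φ) =
      (homRep M L).ρ g (LinearMap.lcomp k L f φ) := by
  intro g hg φ
  refine LinearMap.ext fun m => ?_
  have h := hf g⁻¹ (P.inv_mem hg) m
  change L.ρ g ((φ : N →ₗ[k] L) (N.ρ g⁻¹ (f m))) = L.ρ g ((φ : N →ₗ[k] L) (f (M.ρ g⁻¹ m)))
  rw [h]

theorem eval_equivariant (M N : Rep.{u} k G) {P : Subgroup G} (m : fixedPoints M P) :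
    ∀ g ∈ P, ∀ φ : homRep M N, (LinearMap.applyₗ (R := k) (m : M)) ((homRep M N).ρ g φ) =
      N.ρ g (LinearMap.applyₗ (R := k) (M₂ := N) (m : M) φ) := by
  intro g hg φ
  change N.ρ g ((φ : M →ₗ[k] N) (M.ρ g⁻¹ m)) = N.ρ g ((φ : M →ₗ[k] N) m)
  rw [apply_of_mem M (P.inv_mem hg) m]

theorem hom_equivariant {M N : Rep.{u} k G} (f : M ⟶ N) (P : Subgroup G) :
    ∀ g ∈ P, ∀ m, f.hom.toLinearMap (M.ρ g m) = N.ρ g (f.hom.toLinearMap m) :=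
  fun g _ m => Rep.hom_comm_apply f g m

variable [Finite G]

/-- Half of the ideal property: $f\circ\operatorname{tr}_Q^P(t)=\operatorname{tr}_Q^P(f\circ t)$ for
$P$-equivariant $f$. The other half is `mem_traceSpan_comp`. -/
theorem comp_mem_traceSpan {L M N : Rep.{u} k G} {P : Subgroup G} {Y : Set (Subgroup G)}
    (hY : ∀ Q ∈ Y, Q ≤ P) (f : M →ₗ[k] N) (hf : ∀ g ∈ P, ∀ m, f (M.ρ g m) = N.ρ g (f m))
    {t : fixedPoints (homRep L M) P} (ht : t ∈ traceSpan (homRep L M) P Y) :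
    ∃ s ∈ traceSpan (homRep L N) P Y, (s : L →ₗ[k] N) = f ∘ₗ (t : L →ₗ[k] M) :=
  ⟨_, fixedMap_mem_traceSpan (W := homRep L N) (LinearMap.compRight k f) hY
    (postcomp_equivariant L f hf) ht, rfl⟩

theorem mem_traceSpan_comp {L M N : Rep.{u} k G} {P : Subgroup G} {Y : Set (Subgroup G)}
    (hY : ∀ Q ∈ Y, Q ≤ P) (f : M →ₗ[k] N) (hf : ∀ g ∈ P, ∀ m, f (M.ρ g m) = N.ρ g (f m))
    {t : fixedPoints (homRep N L) P} (ht : t ∈ traceSpan (homRep N L) P Y) :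
    ∃ s ∈ traceSpan (homRep M L) P Y, (s : M →ₗ[k] L) = (t : N →ₗ[k] L) ∘ₗ f :=
  ⟨_, fixedMap_mem_traceSpan (W := homRep M L) (LinearMap.lcomp k L f) hY
    (precomp_equivariant L f hf) ht, rfl⟩

theorem comp_relTrace {L M N : Rep.{u} k G} {P Q : Subgroup G} (hQ : Q ≤ P) (f : M →ₗ[k] N)
    (hf : ∀ g ∈ P, ∀ m, f (M.ρ g m) = N.ρ g (f m)) (t : fixedPoints (homRep L M) Q)
    (s : fixedPoints (homRep L N) Q) (hs : (s : L →ₗ[k] N) = f ∘ₗ (t : L →ₗ[k] M)) :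
    (relTrace (homRep L N) P Q s : L →ₗ[k] N) =
      f ∘ₗ (relTrace (homRep L M) P Q t : L →ₗ[k] M) := by
  have h := fixedMap_relTrace (W := homRep L N) (LinearMap.compRight k f) hQ
    (postcomp_equivariant L f hf) t
  have h2 : fixedMap (W := homRep L N) (LinearMap.compRight k (M := L) f) Q
    (fun g hg => postcomp_equivariant L f hf g (hQ hg)) t = s := Subtype.ext hs.symm
  rw [h2] at h
  exact (congrArg Subtype.val h).symm

theorem relTrace_comp {L M N : Rep.{u} k G} {P Q : Subgroup G} (hQ : Q ≤ P) (f : M →ₗ[k] N)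
    (hf : ∀ g ∈ P, ∀ m, f (M.ρ g m) = N.ρ g (f m)) (t : fixedPoints (homRep N L) Q)
    (s : fixedPoints (homRep M L) Q) (hs : (s : M →ₗ[k] L) = (t : N →ₗ[k] L) ∘ₗ f) :
    (relTrace (homRep M L) P Q s : M →ₗ[k] L) =
      (relTrace (homRep N L) P Q t : N →ₗ[k] L) ∘ₗ f := by
  have h := fixedMap_relTrace (W := homRep M L) (LinearMap.lcomp k L f) hQ
    (precomp_equivariant L f hf) t
  have h2 : fixedMap (W := homRep M L) (LinearMap.lcomp k L f) Q
    (fun g hg => precomp_equivariant L f hf g (hQ hg)) t = s := Subtype.ext hs.symm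
  rw [h2] at h
  exact (congrArg Subtype.val h).symm

/-- The identity of `M` is a sum of traces from members of `Y`. -/
def IsTraceProjective (Y : Set (Subgroup G)) (M : Rep.{u} k G) : Prop :=
  ∃ t ∈ traceSpan (homRep M M) ⊤ Y, (t : M →ₗ[k] M) = LinearMap.id

theorem IsTraceProjective.mono {Y Z : Set (Subgroup G)} (h : Y ⊆ Z) {M : Rep.{u} k G}
    (hM : IsTraceProjective Y M) : IsTraceProjective Z M :=
  let ⟨t, ht, h1⟩ := hM
  ⟨t, traceSpan_mono _ _ h ht, h1⟩

theorem IsTraceProjective.of_retract {Y : Set (Subgroup G)} {M N : Rep.{u} k G}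
    (hM : IsTraceProjective Y M) (r : Retract N M) : IsTraceProjective Y N := by
  obtain ⟨t, ht, h1⟩ := hM
  obtain ⟨s, hs, h2⟩ := comp_mem_traceSpan (fun _ _ => le_top) r.r.hom.toLinearMap
    (hom_equivariant r.r ⊤) ht
  obtain ⟨s', hs', h3⟩ := mem_traceSpan_comp (fun _ _ => le_top) r.i.hom.toLinearMap
    (hom_equivariant r.i ⊤) hs
  refine ⟨s', hs', ?_⟩
  rw [h3, h2, h1]
  exact congrArg (fun f : N ⟶ N => f.hom.toLinearMap) r.retract

theorem isTraceProjective_of_isZero {Y : Set (Subgroup G)} {M : Rep.{u} k G}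
    (hM : IsZero M) : IsTraceProjective Y M := by
  have := (Rep.isZero_iff (k := k) G M).mp hM
  exact ⟨0, Submodule.zero_mem _, LinearMap.ext fun m => Subsingleton.elim _ _⟩

/-- By the ideal property, both idempotents of the decomposition are sums of traces, and they add up
to the identity. -/
theorem isTraceProjective_of_isTraceProjective_summands {Y : Set (Subgroup G)}
    {M A B : Rep.{u} k G} (e : M ≅ A ⊞ B)
    (hA : IsTraceProjective Y A) (hB : IsTraceProjective Y B) : IsTraceProjective Y M := by
  have aux : ∀ {C : Rep.{u} k G} (i : C ⟶ M) (r : M ⟶ C), IsTraceProjective Y C →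
      ∃ t ∈ traceSpan (homRep M M) ⊤ Y, (t : M →ₗ[k] M) = (r ≫ i).hom.toLinearMap := by
    rintro C i r ⟨t, ht, h1⟩
    obtain ⟨s, hs, h2⟩ := comp_mem_traceSpan (fun _ _ => le_top) i.hom.toLinearMap
      (hom_equivariant i ⊤) ht
    obtain ⟨s', hs', h3⟩ := mem_traceSpan_comp (fun _ _ => le_top) r.hom.toLinearMap
      (hom_equivariant r ⊤) hs
    refine ⟨s', hs', ?_⟩
    rw [h3, h2, h1]
    rfl
  obtain ⟨s, hs, h1⟩ := aux (biprod.inl ≫ e.inv) (e.hom ≫ biprod.fst) hA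
  obtain ⟨t, ht, h2⟩ := aux (biprod.inr ≫ e.inv) (e.hom ≫ biprod.snd) hB
  refine ⟨s + t, Submodule.add_mem _ hs ht, ?_⟩
  have h : (e.hom ≫ biprod.fst) ≫ biprod.inl ≫ e.inv +
      (e.hom ≫ biprod.snd) ≫ biprod.inr ≫ e.inv = 𝟙 M := by
    have : e.hom ≫ (biprod.fst ≫ biprod.inl + biprod.snd ≫ biprod.inr) ≫ e.inv = 𝟙 M := by
      rw [biprod.total, Category.id_comp, e.hom_inv_id]
    simpa only [Preadditive.add_comp, Preadditive.comp_add, Category.assoc] using this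
  have h' := congrArg (fun f : M ⟶ M => f.hom.toLinearMap) h
  rw [Submodule.coe_add, h1, h2]
  exact h'

/-- Over $P$ the identity of $M$ becomes a sum of proper traces. Evaluation at the fixed vector $m$
is $P$-equivariant and carries it to an expression of $m$ as such a sum. -/
theorem IsTraceProjective.fixedPoints_le_traceSum {Y : Set (Subgroup G)} {M : Rep.{u} k G}
    (hM : IsTraceProjective Y M) {P : Subgroup G}
    (hY : ∀ H ∈ Y, ∀ g : G, ¬ P ≤ H.map (MulAut.conj g).toMonoidHom) (m : fixedPoints M P) :
    m ∈ traceSum M P := by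
  obtain ⟨t, ht, h1⟩ := hM
  have h := fixedMap_mem_traceSpan (W := M) (LinearMap.applyₗ (R := k) (M₂ := M) (m : M))
    (Y := {Q | Q < P}) (fun Q hQ => le_of_lt hQ) (eval_equivariant M M m)
    (mem_traceSum_of_mem_traceSpan_top _ hY ht)
  rw [traceSum_eq_traceSpan]
  convert h
  refine Subtype.ext ?_
  change (m : M) = (t : M →ₗ[k] M) m
  rw [h1]
  rfl

theorem IsTraceProjective.isZero_brauer {Y : Set (Subgroup G)} {M : Rep.{u} k G}
    (hM : IsTraceProjective Y M) {P : Subgroup G}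
    (hY : ∀ H ∈ Y, ∀ g : G, ¬ P ≤ H.map (MulAut.conj g).toMonoidHom) :
    IsZero ((brauerFunctor k P).obj M) := by
  rw [Rep.isZero_iff]
  refine ⟨fun a b => ?_⟩
  obtain ⟨a, rfl⟩ := Submodule.Quotient.mk_surjective _ a
  obtain ⟨b, rfl⟩ := Submodule.Quotient.mk_surjective _ b
  exact (Submodule.Quotient.eq _).mpr (hM.fixedPoints_le_traceSum hY _)

/-- Every module in characteristic `p` is projective relative to a Sylow `p`-subgroup. -/
theorem isTraceProjective_sylow (p : ℕ) [Fact p.Prime] [CharP k p] (M : Rep.{u} k G) :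
    IsTraceProjective {P | IsPGroup p P} M := by
  obtain ⟨S⟩ := Sylow.nonempty (p := p) (G := G)
  have hc : ((S : Subgroup G).index : k) ≠ 0 := by
    rw [Ne, CharP.cast_eq_zero_iff k p]
    exact S.not_dvd_index
  -- All translates of this scalar map are equal and there are $|G:S|$ of them, so its trace is the
  -- identity; the index is invertible because it is prime to $p$.
  let φ : fixedPoints (homRep M M) S := ⟨((S : Subgroup G).index : k)⁻¹ • LinearMap.id,
    mem_fixedPoints_homRep.mpr fun g _ m => by simp⟩
  refine ⟨_, relTrace_mem_traceSpan (homRep M M) ⊤ (show (S : Subgroup G) ∈ _ from S.2) φ, ?_⟩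
  rw [relTrace_coe]
  have : ∀ x, translate (homRep M M) ⊤ S φ x =
      (((S : Subgroup G).index : k)⁻¹ • LinearMap.id : M →ₗ[k] M) := by
    intro x
    induction x using QuotientGroup.induction_on with
    | H x =>
      rw [translate_mk]
      refine LinearMap.ext fun m => ?_
      change M.ρ (x : G) (((S : Subgroup G).index : k)⁻¹ • M.ρ (x : G)⁻¹ m) = _
      simp
  rw [finsum_congr this]
  have := Fintype.ofFinite ((⊤ : Subgroup G) ⧸ (S : Subgroup G).subgroupOf ⊤)
  rw [finsum_eq_sum_of_fintype, Finset.sum_const, Finset.card_univ, ← Nat.card_eq_fintype_card]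
  have h2 : Nat.card ((⊤ : Subgroup G) ⧸ (S : Subgroup G).subgroupOf ⊤) =
      (S : Subgroup G).index := by
    rw [← Subgroup.relIndex_top_right]
    rfl
  rw [h2, ← Nat.cast_smul_eq_nsmul k, smul_smul, mul_inv_cancel₀ hc, one_smul]

end HomTraces

/-! ### Higman's criterion. -/

section RelativeProjectivity

variable {k G : Type u} [Field k] [Group G]

theorem isDirectSummand_iff_nonempty_retract {M N : Rep.{u} k G} :
    IsDirectSummand N M ↔ Nonempty (Retract N M) := by
  constructor
  · rintro ⟨N', ⟨e⟩⟩
    exact ⟨⟨biprod.inl ≫ e.inv, e.hom ≫ biprod.fst, by simp⟩⟩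
  · rintro ⟨r⟩
    have : Mono r.i := (SplitMono.mk r.r r.retract).mono
    let S := ShortComplex.mk r.i (cokernel.π r.i) (cokernel.condition r.i)
    have hS : S.Exact := ShortComplex.exact_of_g_is_cokernel S (cokernelIsCokernel r.i)
    exact ⟨_, ⟨(ShortComplex.Splitting.ofExactOfRetraction S hS r.r r.retract
      (inferInstanceAs (Epi (cokernel.π r.i)))).isoBinaryBiproduct⟩⟩

theorem finite_of_retract {M N : Rep.{u} k G} [Module.Finite k M] (r : Retract N M) :
    Module.Finite k N :=
  Module.Finite.of_surjective r.r.hom.toLinearMap fun n =>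
    ⟨r.i.hom n, congrArg (fun f : N ⟶ N => f.hom n) r.retract⟩

theorem injective_of_retract {M N : Rep.{u} k G} (r : Retract N M) :
    Function.Injective r.i.hom :=
  Function.LeftInverse.injective (g := r.r.hom) fun n =>
    congrArg (fun f : N ⟶ N => f.hom n) r.retract

theorem indMk_mul (H : Subgroup G) (A : Rep.{u} k H) (g : H) (h : G) (a : A) :
    Representation.IndV.mk H.subtype A.ρ ((g : G) * h) (A.ρ g a) =
      Representation.IndV.mk H.subtype A.ρ h a := by
  have := Representation.Coinvariants.mk_self_apply (Representation.tprod
    ((Representation.leftRegular k G).comp H.subtype) A.ρ) g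
    (TensorProduct.mk k _ _ (MonoidAlgebra.single h 1) a)
  simpa using this

open scoped Classical in
/-- The projection of an induced module onto the summand indexed by the trivial coset. -/
noncomputable def indProj (H : Subgroup G) (A : Rep.{u} k H) :
    Representation.IndV H.subtype A.ρ →ₗ[k] Representation.IndV H.subtype A.ρ :=
  Representation.Coinvariants.lift _ (TensorProduct.lift <|
    (Finsupp.lift _ _ _ fun h => if h ∈ H then Representation.IndV.mk H.subtype A.ρ h else 0) ∘ₗ
      (MonoidAlgebra.coeffLinearEquiv k).toLinearMap) fun g => by
    refine TensorProduct.ext (MonoidAlgebra.lhom_ext' fun h =>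
      LinearMap.ext_ring (LinearMap.ext fun a => ?_))
    have hm : (g : G) * h ∈ H ↔ h ∈ H := H.mul_mem_cancel_left g.2
    by_cases h1 : h ∈ H
    · simpa [hm, h1] using indMk_mul H A g h a
    · simp [hm, h1]

theorem indProj_mk_of_mem {H : Subgroup G} (A : Rep.{u} k H) {h : G} (hh : h ∈ H) (a : A) :
    indProj H A (Representation.IndV.mk H.subtype A.ρ h a) =
      Representation.IndV.mk H.subtype A.ρ h a := by
  simp [indProj, hh]

theorem indProj_mk_of_notMem {H : Subgroup G} (A : Rep.{u} k H) {h : G} (hh : h ∉ H) (a : A) :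
    indProj H A (Representation.IndV.mk H.subtype A.ρ h a) = 0 := by
  simp [indProj, hh]

variable [Finite G]

/-- The $G$-translates of the projection onto the trivial coset are the projections onto the other
cosets, and together they sum to the identity. -/
theorem exists_relTrace_eq_id_ind (H : Subgroup G) (A : Rep.{u} k H) :
    ∃ φ : fixedPoints (homRep (Rep.ind H.subtype A) (Rep.ind H.subtype A)) H,
      (relTrace _ ⊤ H φ : Rep.ind H.subtype A →ₗ[k] Rep.ind H.subtype A) = LinearMap.id := by
  classical
  have hfix : ∀ g ∈ H, ∀ m, indProj H A ((Rep.ind H.subtype A).ρ g m) =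
      (Rep.ind H.subtype A).ρ g (indProj H A m) := by
    intro g hg m
    suffices h : indProj H A ∘ₗ (A.ρ.ind H.subtype g) = (A.ρ.ind H.subtype g) ∘ₗ indProj H A from
      LinearMap.congr_fun h m
    refine Representation.IndV.hom_ext _ _ fun h => LinearMap.ext fun a => ?_
    change indProj H A (A.ρ.ind H.subtype g (Representation.IndV.mk H.subtype A.ρ h a)) =
      A.ρ.ind H.subtype g (indProj H A (Representation.IndV.mk H.subtype A.ρ h a))
    rw [Representation.ind_mk]
    have hm : h * g⁻¹ ∈ H ↔ h ∈ H := H.mul_mem_cancel_right (H.inv_mem hg)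
    by_cases h1 : h ∈ H
    · rw [indProj_mk_of_mem A h1, indProj_mk_of_mem A (hm.mpr h1), Representation.ind_mk]
    · rw [indProj_mk_of_notMem A h1, indProj_mk_of_notMem A (mt hm.mp h1), map_zero]
  refine ⟨⟨indProj H A, mem_fixedPoints_homRep.mpr hfix⟩, ?_⟩
  set φ : fixedPoints (homRep (Rep.ind H.subtype A) (Rep.ind H.subtype A)) H :=
    ⟨indProj H A, mem_fixedPoints_homRep.mpr hfix⟩ with hφ
  have hT := mem_fixedPoints_homRep.mp (relTrace _ ⊤ H φ).2
  -- Being $G$-equivariant, the trace is determined on the trivial coset, where only the term $x\in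
  -- H$ survives.
  have h1 : ∀ a, (relTrace _ ⊤ H φ : Rep.ind H.subtype A →ₗ[k] Rep.ind H.subtype A)
      (Representation.IndV.mk H.subtype A.ρ 1 a) = Representation.IndV.mk H.subtype A.ρ 1 a := by
    intro a
    have hx : ∀ x : (⊤ : Subgroup G), (translate _ ⊤ H φ x : _ →ₗ[k] _)
        (Representation.IndV.mk H.subtype A.ρ 1 a) =
          A.ρ.ind H.subtype (x : G) (indProj H A (Representation.IndV.mk H.subtype A.ρ x a)) := by
      intro x
      rw [translate_mk]
      change A.ρ.ind H.subtype (x : G) (indProj H A (A.ρ.ind H.subtype (x : G)⁻¹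
        (Representation.IndV.mk H.subtype A.ρ 1 a))) = _
      rw [Representation.ind_mk]
      simp
    rw [relTrace_coe]
    change LinearMap.applyₗ (R := k) (Representation.IndV.mk H.subtype A.ρ 1 a) (∑ᶠ _, _) = _
    rw [map_finsum _ (Set.toFinite _), finsum_eq_single _ ((1 : (⊤ : Subgroup G)) :
      (⊤ : Subgroup G) ⧸ H.subgroupOf ⊤)]
    · refine (hx 1).trans ?_
      rw [Subgroup.coe_one, indProj_mk_of_mem A H.one_mem, map_one]
      rfl
    · intro x hx1
      induction x using QuotientGroup.induction_on with
      | H x =>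
        refine (hx x).trans ?_
        rw [indProj_mk_of_notMem, map_zero]
        intro hxH
        refine hx1 (QuotientGroup.eq.mpr ?_)
        simpa [Subgroup.mem_subgroupOf] using hxH
  refine Representation.IndV.hom_ext _ _ fun h => LinearMap.ext fun a => ?_
  have h2 : Representation.IndV.mk H.subtype A.ρ h a =
      A.ρ.ind H.subtype h⁻¹ (Representation.IndV.mk H.subtype A.ρ 1 a) := by
    rw [Representation.ind_mk]
    simp
  change (relTrace _ ⊤ H φ : Rep.ind H.subtype A →ₗ[k] Rep.ind H.subtype A)
    (Representation.IndV.mk H.subtype A.ρ h a) = Representation.IndV.mk H.subtype A.ρ h a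
  rw [h2]
  refine (hT h⁻¹ trivial _).trans ?_
  rw [h1]

/-- In one direction, the trace expression on the induced module is carried along the retraction. In
the other, composing $\varphi$ with the embedding of $M$ at the trivial coset and taking the trace
splits the counit $\operatorname{Ind}\operatorname{Res}M\to M$. -/
theorem isRelProjective_iff (H : Subgroup G) (M : Rep.{u} k G) [Module.Finite k M] :
    IsRelProjective H M ↔ ∃ φ : fixedPoints (homRep M M) H,
      (relTrace _ ⊤ H φ : M →ₗ[k] M) = LinearMap.id := by
  constructor
  · rintro ⟨A, -, hA⟩
    obtain ⟨r⟩ := isDirectSummand_iff_nonempty_retract.mp hA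
    obtain ⟨φ, hφ⟩ := exists_relTrace_eq_id_ind H A
    have hf := mem_fixedPoints_homRep.mp φ.2
    have h1 := fun g (hg : g ∈ H) => postcomp_equivariant (Rep.ind H.subtype A)
      r.r.hom.toLinearMap (hom_equivariant r.r H) g hg
    have h2 := fun g (hg : g ∈ H) => precomp_equivariant M
      r.i.hom.toLinearMap (hom_equivariant r.i H) g hg
    refine ⟨fixedMap (W := homRep M M) _ H h2 (fixedMap (W := homRep _ M) _ H h1 φ), ?_⟩
    rw [relTrace_comp (L := M) le_top r.i.hom.toLinearMap (hom_equivariant r.i ⊤)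
      (fixedMap (W := homRep _ M) _ H h1 φ) _ rfl, comp_relTrace le_top r.r.hom.toLinearMap
      (hom_equivariant r.r ⊤) φ _ rfl, hφ]
    exact congrArg (fun f : M ⟶ M => f.hom.toLinearMap) r.retract
  · rintro ⟨φ, hφ⟩
    let A : Rep.{u} k H := Rep.res H.subtype M
    let ε : Rep.ind H.subtype A ⟶ M := (Rep.indResHomEquiv H.subtype A M).symm (𝟙 A)
    have hε : ∀ m : M, ε.hom (Representation.IndV.mk H.subtype A.ρ 1 m) = m := by
      intro m
      exact congrArg (fun f : A ⟶ A => f.hom m)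
        ((Rep.indResHomEquiv H.subtype A M).apply_symm_apply (𝟙 A))
    let σ : M →ₗ[k] Rep.ind H.subtype A :=
      Representation.IndV.mk H.subtype A.ρ 1 ∘ₗ (φ : M →ₗ[k] M)
    have hσ : σ ∈ fixedPoints (homRep M (Rep.ind H.subtype A)) H := by
      refine mem_fixedPoints_homRep.mpr fun g hg m => ?_
      change Representation.IndV.mk H.subtype A.ρ 1 ((φ : M →ₗ[k] M) (M.ρ g m)) =
        A.ρ.ind H.subtype g (Representation.IndV.mk H.subtype A.ρ 1 ((φ : M →ₗ[k] M) m))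
      rw [mem_fixedPoints_homRep.mp φ.2 g hg, Representation.ind_mk, one_mul,
        ← indMk_mul H A ⟨g, hg⟩ g⁻¹]
      simp only [mul_inv_cancel]
      rfl
    refine ⟨A, inferInstanceAs (Module.Finite k M), isDirectSummand_iff_nonempty_retract.mpr
      ⟨⟨homOfFixed (relTrace _ ⊤ H ⟨σ, hσ⟩), ε, ?_⟩⟩⟩
    have h := comp_relTrace le_top ε.hom.toLinearMap (hom_equivariant ε ⊤) ⟨σ, hσ⟩ φ
      (LinearMap.ext fun m => (hε _).symm)
    rw [hφ] at h
    ext m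
    exact (LinearMap.congr_fun h m).symm

end RelativeProjectivity

/-! ### Fitting's lemma and indecomposable summands. -/

section Fitting

variable {k G : Type u} [Field k] [Group G]

theorem isIso_of_bijective {M N : Rep.{u} k G} (f : M ⟶ N) (hf : Function.Bijective f.hom) :
    IsIso f :=
  (ConcreteCategory.isIso_iff_bijective f).mpr hf

theorem bijective_of_isIso {M N : Rep.{u} k G} (f : M ⟶ N) [IsIso f] :
    Function.Bijective f.hom :=
  ConcreteCategory.bijective_of_isIso f

theorem isIso_of_injective {M : Rep.{u} k G} [Module.Finite k M] (f : M ⟶ M)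
    (hf : Function.Injective f.hom) : IsIso f :=
  isIso_of_bijective f ⟨hf, LinearMap.injective_iff_surjective (f := f.hom.toLinearMap).mp hf⟩

/-- On the image of $F$ the composite `i ≫ q` is $F$ itself; the condition $\ker F^2=\ker F$ makes
it injective, hence bijective by finite dimension. -/
theorem isIso_of_factorization {M E : Rep.{u} k G} [Module.Finite k M] (F : M ⟶ M) (q : M ⟶ E)
    (i : E ⟶ M) [Epi q] [Mono i] (h : q ≫ i = F)
    (hF : ∀ x, F.hom (F.hom x) = 0 → F.hom x = 0) : IsIso (i ≫ q) := by
  have hq := (Rep.epi_iff_surjective q).mp inferInstance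
  have hi := (Rep.mono_iff_injective i).mp inferInstance
  have : Module.Finite k E := Module.Finite.of_surjective q.hom.toLinearMap hq
  refine isIso_of_injective _ ?_
  refine (injective_iff_map_eq_zero (i ≫ q).hom.toLinearMap).mpr fun x hx => ?_
  obtain ⟨y, rfl⟩ := hq x
  have hFy : ∀ y, F.hom y = i.hom (q.hom y) := fun y => by rw [← h]; rfl
  have h1 : q.hom (i.hom (q.hom y)) = 0 := hx
  have h2 := hF y (by rw [hFy, hFy, h1, map_zero])
  rw [hFy] at h2
  exact hi (h2.trans (map_zero _).symm)

theorem end_pow_apply {M : Rep.{u} k G} (f : End M) (n : ℕ) (x : M) :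
    (f ^ n : End M).hom x = (f.hom.toLinearMap ^ n) x := by
  induction n generalizing x with
  | zero => rfl
  | succ n ih =>
    rw [pow_succ, pow_succ, End.mul_def]
    exact ih _

theorem end_pow_pow_eq_zero {M : Rep.{u} k G} [Module.Finite k M] (f : End M) {n : ℕ}
    (hn : Module.finrank k M ≤ n) (x : M)
    (hx : (f ^ n : End M).hom ((f ^ n : End M).hom x) = 0) : (f ^ n : End M).hom x = 0 := by
  rw [end_pow_apply, end_pow_apply, ← Module.End.mul_apply, ← pow_add] at hx
  rw [end_pow_apply]
  have h : x ∈ LinearMap.ker (f.hom.toLinearMap ^ (n + n)) := hx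
  rwa [Module.End.ker_pow_eq_ker_pow_finrank_of_le (by omega),
    ← Module.End.ker_pow_eq_ker_pow_finrank_of_le hn] at h

theorem isIso_or_isIso_one_sub {M : Rep.{u} k G} [Module.Finite k M] (hM : Indecomposable M)
    (f : End M) : IsIso f ∨ IsIso (𝟙 M - (show M ⟶ M from f)) := by
  -- At this power the kernels have stabilized, so the image of $f^n$ is a summand: zero or
  -- everything. The extra $1$ keeps the exponent nonzero, so that $f$ is a unit when $f^n$ is.
  let n := Module.finrank k M + 1
  let F : M ⟶ M := f ^ n
  have hfac : Abelian.factorThruImage F ≫ Abelian.image.ι F = F := Abelian.image.fac F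
  have hiso : IsIso (Abelian.image.ι F ≫ Abelian.factorThruImage F) :=
    isIso_of_factorization F _ _ hfac (end_pow_pow_eq_zero f (Nat.le_succ _))
  let r : Retract (Abelian.image F) M :=
    ⟨Abelian.image.ι F, Abelian.factorThruImage F ≫
      inv (Abelian.image.ι F ≫ Abelian.factorThruImage F), by
      rw [← Category.assoc, IsIso.hom_inv_id]⟩
  obtain ⟨N', ⟨e⟩⟩ := isDirectSummand_iff_nonempty_retract.mpr ⟨r⟩
  obtain h0 | h0 := hM.2 _ _ e
  · right
    have hF0 : f ^ n = 0 := by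
      change F = 0
      rw [← hfac, h0.eq_of_tgt (Abelian.factorThruImage F) 0, zero_comp]
    exact (isUnit_iff_isIso _).mp (IsNilpotent.isUnit_one_sub ⟨n, hF0⟩)
  · left
    have h1 : IsIso (biprod.inl : Abelian.image F ⟶ _ ⊞ N') :=
      (Biprod.isIso_inl_iff_isZero _ _).mpr h0
    let e' : Abelian.image F ≅ M := asIso biprod.inl ≪≫ e.symm
    have hi := (Rep.mono_iff_injective (Abelian.image.ι F)).mp inferInstance
    have h2 : IsIso (e'.inv ≫ Abelian.image.ι F) := isIso_of_injective _
      (hi.comp (bijective_of_isIso e'.inv).1)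
    have h3 : IsIso (Abelian.image.ι F) := IsIso.of_isIso_comp_left e'.inv _
    have h4 : IsIso (Abelian.factorThruImage F) := IsIso.of_isIso_comp_left (Abelian.image.ι F) _
    have h5 : IsIso F := by rw [← hfac]; infer_instance
    have h6 : IsUnit (f ^ n) := (isUnit_iff_isIso _).mpr h5
    exact (isUnit_iff_isIso _).mp ((isUnit_pow_iff (Nat.succ_ne_zero _)).mp h6)

variable [Finite G]

/-- Rosenberg's argument: the endomorphism ring is local, so in an invertible sum of traces one
trace is invertible. Composing it with its inverse gives the identity as a single trace. -/
theorem Indecomposable.exists_relTrace_eq_id {M : Rep.{u} k G} [Module.Finite k M]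
    (hM : Indecomposable M) {Y : Set (Subgroup G)} (h : IsTraceProjective Y M) :
    ∃ H ∈ Y, ∃ φ : fixedPoints (homRep M M) H,
      (relTrace _ ⊤ H φ : M →ₗ[k] M) = LinearMap.id := by
  obtain ⟨t, ht, h1⟩ := h
  have hid : homOfFixed t = 𝟙 M := by
    ext m
    exact LinearMap.congr_fun h1 m
  have hiso : IsIso (homOfFixed t) := by rw [hid]; infer_instance
  clear hid h1
  have hrange : ∀ H ∈ Y, ∀ φ : fixedPoints (homRep M M) H,
      IsIso (homOfFixed (relTrace _ ⊤ H φ)) → ∃ H ∈ Y, ∃ φ : fixedPoints (homRep M M) H,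
        (relTrace _ ⊤ H φ : M →ₗ[k] M) = LinearMap.id := by
    intro H hH φ hφ
    let w := inv (homOfFixed (relTrace _ ⊤ H φ))
    refine ⟨H, hH, fixedMap (W := homRep M M) (LinearMap.compRight k w.hom.toLinearMap) H
      (postcomp_equivariant M _ (hom_equivariant w H)) φ, ?_⟩
    rw [comp_relTrace le_top w.hom.toLinearMap (hom_equivariant w ⊤) φ _ rfl]
    exact congrArg (fun f : M ⟶ M => f.hom.toLinearMap)
      (IsIso.hom_inv_id (homOfFixed (relTrace _ ⊤ H φ)))
  refine Submodule.iSup_induction _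
    (motive := fun t => IsIso (homOfFixed t) → ∃ H ∈ Y, ∃ φ : fixedPoints (homRep M M) H,
      (relTrace _ ⊤ H φ : M →ₗ[k] M) = LinearMap.id) ht ?_ ?_ ?_ hiso
  · intro H x hx hix
    by_cases hH : H ∈ Y
    · simp only [hH, iSup_pos] at hx
      obtain ⟨φ, rfl⟩ := hx
      exact hrange H hH φ hix
    · simp only [hH, iSup_false] at hx
      exfalso
      rw [(Submodule.mem_bot k).mp hx] at hix
      refine hM.1 ((Rep.isZero_iff (k := k) G M).mpr ⟨fun a b => ?_⟩)
      exact (bijective_of_isIso (homOfFixed (0 : fixedPoints (homRep M M) ⊤))).1 rfl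
  · intro hix
    exfalso
    refine hM.1 ((Rep.isZero_iff (k := k) G M).mpr ⟨fun a b => ?_⟩)
    exact (bijective_of_isIso (homOfFixed (0 : fixedPoints (homRep M M) ⊤))).1 rfl
  · intro x y hx hy hxy
    let v : M ⟶ M := inv (homOfFixed (x + y))
    have hsum : homOfFixed x ≫ v + homOfFixed y ≫ v = 𝟙 M := by
      rw [← Preadditive.add_comp]
      exact IsIso.hom_inv_id (homOfFixed (x + y))
    obtain h | h := isIso_or_isIso_one_sub hM (homOfFixed x ≫ v)
    · exact hx (IsIso.of_isIso_comp_right _ v)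
    · rw [← hsum, add_sub_cancel_left] at h
      exact hy (IsIso.of_isIso_comp_right _ v)

/-- From left to right by induction on the dimension, splitting a decomposable module into two
smaller ones, so that no Krull–Schmidt decomposition is needed. -/
theorem isSetProjective_iff {Y : Set (Subgroup G)} {M : Rep.{u} k G} [Module.Finite k M] :
    IsSetProjective Y M ↔ IsTraceProjective Y M := by
  constructor
  · intro h
    induction hn : Module.finrank k M using Nat.strong_induction_on generalizing M with
    | _ n ih =>
      by_cases h0 : IsZero M
      · exact isTraceProjective_of_isZero h0
      by_cases hM : Indecomposable M
      · obtain ⟨H, hH, hp⟩ := h M hM (isDirectSummand_iff_nonempty_retract.mpr ⟨Retract.refl M⟩)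
        obtain ⟨φ, hφ⟩ := (isRelProjective_iff H M).mp hp
        exact ⟨_, relTrace_mem_traceSpan _ _ hH φ, hφ⟩
      · obtain ⟨A, B, ⟨e⟩, hA, hB⟩ : ∃ A B, Nonempty (M ≅ A ⊞ B) ∧ ¬ IsZero A ∧ ¬ IsZero B := by
          by_contra hc
          push Not at hc
          refine hM ⟨h0, fun A B e => ?_⟩
          by_cases hA : IsZero A
          · exact Or.inl hA
          · exact Or.inr (hc A B ⟨e⟩ hA)
        have key : ∀ {A B : Rep.{u} k G} (e : M ≅ A ⊞ B), ¬ IsZero B →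
            IsTraceProjective Y A := by
          intro A B e hB
          let rA : Retract A M := ⟨biprod.inl ≫ e.inv, e.hom ≫ biprod.fst, by simp⟩
          have := finite_of_retract rA
          refine ih (Module.finrank k A) ?_ (fun N hN hNA => ?_) rfl
          · rw [← hn]
            refine lt_of_le_of_ne
              (LinearMap.finrank_le_finrank_of_injective (f := rA.i.hom.toLinearMap)
                (injective_of_retract rA)) fun heq => hB ?_
            have hb : IsIso rA.i := isIso_of_bijective _ ⟨injective_of_retract rA,
              (LinearMap.injective_iff_surjective_of_finrank_eq_finrank
                (f := rA.i.hom.toLinearMap) heq).mp (injective_of_retract rA)⟩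
            have : IsIso (biprod.inl : A ⟶ A ⊞ B) := IsIso.of_isIso_comp_right _ e.inv
            exact (Biprod.isIso_inl_iff_isZero _ _).mp this
          · obtain ⟨r⟩ := isDirectSummand_iff_nonempty_retract.mp hNA
            exact h N hN (isDirectSummand_iff_nonempty_retract.mpr ⟨r.trans rA⟩)
        exact isTraceProjective_of_isTraceProjective_summands e (key e hB)
          (key (e ≪≫ biprod.braiding A B) hA)
  · intro h N hN hNM
    obtain ⟨r⟩ := isDirectSummand_iff_nonempty_retract.mp hNM
    have := finite_of_retract r
    obtain ⟨H, hH, hφ⟩ := Indecomposable.exists_relTrace_eq_id hN (h.of_retract r)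
    exact ⟨H, hH, (isRelProjective_iff H N).mpr hφ⟩

theorem projective_iff {M : Rep.{u} k G} [Module.Finite k M] :
    Projective M ↔ IsTraceProjective {⊥} M := by
  constructor
  · intro hM
    let A : Rep.{u} k (⊥ : Subgroup G) := Rep.res (⊥ : Subgroup G).subtype M
    let ε : Rep.ind (⊥ : Subgroup G).subtype A ⟶ M :=
      (Rep.indResHomEquiv (⊥ : Subgroup G).subtype A M).symm (𝟙 A)
    have hε : ∀ m : M, ε.hom (Representation.IndV.mk (⊥ : Subgroup G).subtype A.ρ 1 m) = m := by
      intro m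
      exact congrArg (fun f : A ⟶ A => f.hom m)
        ((Rep.indResHomEquiv (⊥ : Subgroup G).subtype A M).apply_symm_apply (𝟙 A))
    have : Epi ε := (Rep.epi_iff_surjective ε).mpr fun m => ⟨_, hε m⟩
    have hr : IsRelProjective ⊥ M := ⟨A, inferInstanceAs (Module.Finite k M),
      isDirectSummand_iff_nonempty_retract.mpr
        ⟨⟨Projective.factorThru (𝟙 M) ε, ε, Projective.factorThru_comp _ _⟩⟩⟩
    obtain ⟨φ, hφ⟩ := (isRelProjective_iff ⊥ M).mp hr
    exact ⟨_, relTrace_mem_traceSpan _ _ (Set.mem_singleton _) φ, hφ⟩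
  · rintro ⟨t, ht, h1⟩
    simp only [traceSpan, Set.mem_singleton_iff, iSup_iSup_eq_left] at ht
    obtain ⟨φ, rfl⟩ := ht
    refine ⟨fun {E X} f e he => ?_⟩
    have hs := (Rep.epi_iff_surjective e).mp he
    -- A $k$-linear lift becomes $G$-equivariant after composing with $\varphi$ and taking the trace
    -- from the trivial subgroup.
    obtain ⟨l, hl⟩ := Module.projective_lifting_property e.hom.toLinearMap f.hom.toLinearMap hs
    have hfix : l ∘ₗ (φ : M →ₗ[k] M) ∈ fixedPoints (homRep M E) ⊥ := by
      refine mem_fixedPoints_homRep.mpr fun g hg m => ?_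
      obtain rfl := Subgroup.mem_bot.mp hg
      simp
    refine ⟨homOfFixed (relTrace _ ⊤ ⊥ ⟨_, hfix⟩), ?_⟩
    have h2 := comp_relTrace le_top e.hom.toLinearMap (hom_equivariant e ⊤) ⟨_, hfix⟩
      (fixedMap (W := homRep M X) _ ⊥ (postcomp_equivariant M _ (hom_equivariant f ⊥)) φ)
      (LinearMap.ext fun m => (LinearMap.congr_fun hl ((φ : M →ₗ[k] M) m)).symm)
    rw [comp_relTrace le_top f.hom.toLinearMap (hom_equivariant f ⊤) φ _ rfl, h1] at h2
    ext m
    exact (LinearMap.congr_fun h2 m).symm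

end Fitting

/-! ### Retracts of permutation modules of a $p$-group. -/

section PermutationModules

variable {k P M : Type*} [Field k] [Group P] [Finite P] [AddCommGroup M] [Module k M]

/-- A nonzero stable subspace of a representation of a `p`-group in characteristic `p` contains a
nonzero fixed vector. -/
theorem exists_fixed_vector (p : ℕ) [Fact p.Prime] [CharP k p] (hP : IsPGroup p P)
    (ρ : Representation k P M) (W : Submodule k M) (hW : ∀ g, ∀ w ∈ W, ρ g w ∈ W) {w : M}
    (hw : w ∈ W) (hw0 : w ≠ 0) : ∃ x ∈ W, x ≠ 0 ∧ ∀ g, ρ g x = x := by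
  let _ : Algebra (ZMod p) k := ZMod.algebra k p
  let _ : Module (ZMod p) M := Module.compHom M (algebraMap (ZMod p) k)
  have hs : ∀ (c : ZMod p) (m : M), c • m = (algebraMap (ZMod p) k c) • m := fun _ _ => rfl
  -- The $\mathbb F_p$-span of the orbit of $w$ is a finite nonzero $P$-set of $p$-power order.
  -- Since $0$ is fixed, counting modulo $p$ yields a second fixed point.
  let S : Submodule (ZMod p) M := Submodule.span (ZMod p) (Set.range fun g => ρ g w)
  have hSfin : Module.Finite (ZMod p) S :=
    Module.Finite.span_of_finite (ZMod p) (Set.finite_range _)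
  have hfin : Finite S := Module.finite_of_finite (ZMod p)
  have hSW : ∀ x ∈ S, x ∈ W := by
    intro x hx
    induction hx using Submodule.span_induction with
    | mem x hx => obtain ⟨g, rfl⟩ := hx; exact hW g w hw
    | zero => exact W.zero_mem
    | add x y _ _ h1 h2 => exact W.add_mem h1 h2
    | smul c x _ h1 => exact W.smul_mem _ h1
  have hSρ : ∀ g, ∀ x ∈ S, ρ g x ∈ S := by
    intro g x hx
    induction hx using Submodule.span_induction with
    | mem x hx =>
      obtain ⟨h, rfl⟩ := hx
      refine Submodule.subset_span ⟨g * h, ?_⟩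
      simp
    | zero => rw [map_zero]; exact S.zero_mem
    | add x y _ _ h1 h2 => rw [map_add]; exact S.add_mem h1 h2
    | smul c x _ h1 => rw [hs, map_smul]; exact S.smul_mem c h1
  let _ : MulAction P S :=
    { smul := fun g x => ⟨ρ g x, hSρ g x x.2⟩
      one_smul := fun x => Subtype.ext (by change ρ 1 (x : M) = x; simp)
      mul_smul := fun g h x => Subtype.ext (by
        change ρ (g * h) (x : M) = ρ g (ρ h x); simp) }
  have hwS : w ∈ S := Submodule.subset_span ⟨1, by simp⟩
  have hdvd : p ∣ Nat.card S := by
    rw [Module.natCard_eq_pow_finrank (K := ZMod p), Nat.card_zmod]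
    refine dvd_pow_self p fun h0 => ?_
    have := Module.finrank_zero_iff.mp h0
    exact hw0 (congrArg Subtype.val (Subsingleton.elim (⟨w, hwS⟩ : S) 0))
  obtain ⟨x, hx, hx0⟩ := hP.exists_fixed_point_of_prime_dvd_card_of_fixed_point S hdvd
    (a := (0 : S)) (fun g => Subtype.ext (map_zero (ρ g)))
  refine ⟨x, hSW x x.2, fun h => hx0 (Subtype.ext h.symm), fun g => ?_⟩
  exact congrArg Subtype.val (hx g)

/-- An invariant matrix on a transitive `P`-set is injective if its row sums are nonzero. -/
theorem eq_zero_of_invariant_matrix (p : ℕ) [Fact p.Prime] [CharP k p] (hP : IsPGroup p P)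
    {O : Type*} [Fintype O] [MulAction P O] [MulAction.IsPretransitive P O] (a : O → O → k)
    (ha : ∀ (g : P) x y, a (g • x) (g • y) = a x y) (o : O) (hc : ∑ y, a o y ≠ 0) (x : O → k)
    (hx : ∀ y, ∑ z, a y z * x z = 0) : x = 0 := by
  by_contra hx0
  let ρ : Representation k P (O → k) :=
    { toFun := fun g => LinearMap.funLeft k k (fun y => g⁻¹ • y)
      map_one' := by ext; simp [LinearMap.funLeft]
      map_mul' := fun g h => by ext; simp [LinearMap.funLeft, mul_smul] }
  have hρ : ∀ g (f : O → k) y, ρ g f y = f (g⁻¹ • y) := fun _ _ _ => rfl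
  let W : Submodule k (O → k) :=
    { carrier := {f | ∀ y, ∑ z, a y z * f z = 0}
      zero_mem' := by simp
      add_mem' := fun {f g} hf hg y => by simp [mul_add, Finset.sum_add_distrib, hf y, hg y]
      smul_mem' := fun c f hf y => by
        have : ∑ z, a y z * (c • f) z = c * ∑ z, a y z * f z := by
          rw [Finset.mul_sum]
          exact Finset.sum_congr rfl fun z _ => by simp; ring
        rw [this, hf y, mul_zero] }
  obtain ⟨f, hf, hf0, hfix⟩ := exists_fixed_vector p hP ρ W (fun g f hf y => by
    have h := hf (g⁻¹ • y)
    rw [← h, ← Equiv.sum_comp (MulAction.toPerm g)]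
    refine Finset.sum_congr rfl fun z _ => ?_
    rw [MulAction.toPerm_apply, hρ, inv_smul_smul, ← ha g (g⁻¹ • y), smul_inv_smul]) hx hx0
  -- A fixed function on a transitive set is constant, so being in the kernel means that constant
  -- times row sum vanishes.
  have hconst : ∀ y, f y = f o := by
    intro y
    obtain ⟨g, hg⟩ := MulAction.exists_smul_eq P y o
    have := congrFun (hfix g) o
    rw [hρ, ← hg, inv_smul_smul] at this
    rw [this, hg]
  have h := hf o
  simp only [hconst, ← Finset.sum_mul] at h
  rcases mul_eq_zero.mp h with h | h
  · exact hc h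
  · exact hf0 (funext fun y => (hconst y).trans h)

/-- A finite spanning family permuted by `P` with an equivariant linear section of the
presentation it defines. -/
def HasFrame (ρ : Representation k P M) (n : ℕ) : Prop :=
  ∃ (Ω : Type) (_ : Fintype Ω) (_ : MulAction P Ω) (r : Ω → M) (i : Ω → M →ₗ[k] k),
    Fintype.card Ω = n ∧ (∀ (g : P) ω, r (g • ω) = ρ g (r ω)) ∧
      (∀ (g : P) ω m, i (g • ω) (ρ g m) = i ω m) ∧ ∀ m, ∑ ω, i ω m • r ω = m

/-- `M` has a finite basis permuted by `P`. -/
def HasPermutedBasis (ρ : Representation k P M) : Prop :=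
  ∃ (ι : Type) (_ : Fintype ι) (b : Module.Basis ι k M), ∀ g i, ∃ j, ρ g (b i) = b j

end PermutationModules

/-- Induction on the size of the frame. For an orbit $O$, let $a$ be the matrix of $k[O]\to M\to
k[O]$. If its row sum is nonzero, $a$ is invertible and $k[O]$ splits off $M$. If it is zero, $1-a$
has row sum $1$ and is invertible, so the frame without $O$ still presents $M$ after a twist. Either
way the orbit is discarded. -/
theorem HasFrame.hasPermutedBasis {k P : Type*} [Field k] [Group P] [Finite P] (p : ℕ)
    [Fact p.Prime] [CharP k p] (hP : IsPGroup p P) (n : ℕ) :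
    ∀ {M : Type u} [AddCommGroup M] [Module k M] (ρ : Representation k P M),
      HasFrame ρ n → HasPermutedBasis ρ := by
  classical
  induction n using Nat.strong_induction_on with
  | _ n ih =>
    rintro M _ _ ρ ⟨Ω, _, _, r, i, rfl, hr, hi, hri⟩
    rcases isEmpty_or_nonempty Ω with hΩ | ⟨⟨o⟩⟩
    · have : Subsingleton M := ⟨fun a b => by rw [← hri a, ← hri b]; simp⟩
      exact ⟨Empty, inferInstance, Module.Basis.empty M, fun _ i => i.elim⟩
    let O : Set Ω := MulAction.orbit P o
    let a : O → O → k := fun x y => i x (r y)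
    have ha : ∀ (g : P) x y, a (g • x) (g • y) = a x y := fun g x y => by
      change i (g • (x : Ω)) (r (g • (y : Ω))) = _
      rw [hr, hi]
    have hmemO : ∀ (g : P) (ω : Ω), g • ω ∈ O ↔ ω ∈ O := fun g ω => by
      rw [← MulAction.orbit_eq_iff, ← MulAction.orbit_eq_iff, MulAction.orbit_smul]
    let _ : MulAction P {ω // ω ∉ O} :=
      { smul := fun g ω => ⟨g • (ω : Ω), fun h => ω.2 ((hmemO g ω).mp h)⟩
        one_smul := fun ω => Subtype.ext (one_smul P (ω : Ω))
        mul_smul := fun g h ω => Subtype.ext (mul_smul g h (ω : Ω)) }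
    have hcoe : ∀ (g : P) (ω : {ω // ω ∉ O}), ((g • ω : {ω // ω ∉ O}) : Ω) = g • (ω : Ω) :=
      fun _ _ => rfl
    have hcard : Fintype.card {ω // ω ∉ O} < Fintype.card Ω :=
      Fintype.card_subtype_lt (x := o) (by simp [O])
    let pr : M →ₗ[k] (O → k) := LinearMap.pi fun ω : O => i ω
    let s : (O → k) →ₗ[k] M := Fintype.linearCombination k fun ω : O => r ω
    have hs : ∀ x, s x = ∑ ω : O, x ω • r ω := fun x => Fintype.linearCombination_apply ..
    have hsplit : ∀ m, s (pr m) + ∑ ω : {ω // ω ∉ O}, i ω m • r ω = m := by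
      intro m
      rw [hs]
      conv_rhs => rw [← hri m]
      exact Fintype.sum_subtype_add_sum_subtype (· ∈ O) fun ω => i ω m • r ω
    have hprs : ∀ x y, pr (s x) y = ∑ z, a y z * x z := by
      intro x y
      change i y (s x) = _
      rw [hs, map_sum]
      refine Finset.sum_congr rfl fun z _ => ?_
      rw [map_smul, smul_eq_mul, mul_comm]
    have hprρ : ∀ (g : P) m (y : O), pr (ρ g m) (g • y) = pr m y := fun g m y => hi g y m
    have hsρ : ∀ (g : P) (x x' : O → k), (∀ y, x' (g • y) = x y) → s x' = ρ g (s x) := by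
      intro g x x' hx
      rw [hs, hs, map_sum, ← Equiv.sum_comp (MulAction.toPerm g)]
      refine Finset.sum_congr rfl fun y _ => ?_
      rw [MulAction.toPerm_apply, hx, map_smul, ← hr]
      rfl
    have hfin : Module.Finite k M := by
      refine Module.Finite.of_surjective (Fintype.linearCombination k r) fun m => ⟨fun ω => i ω m, ?_⟩
      rw [Fintype.linearCombination_apply, hri]
    by_cases hc : ∑ y, a ⟨o, MulAction.mem_orbit_self o⟩ y = 0
    · let T : M →ₗ[k] M := LinearMap.id - s ∘ₗ pr
      have hT : ∀ m, T m = ∑ ω : {ω // ω ∉ O}, i ω m • r ω := fun m => by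
        change m - s (pr m) = _
        rw [sub_eq_iff_eq_add', hsplit]
      have hTρ : ∀ g m, T (ρ g m) = ρ g (T m) := fun g m => by
        change ρ g m - s (pr (ρ g m)) = ρ g (m - s (pr m))
        rw [map_sub, hsρ g (pr m) (pr (ρ g m)) (hprρ g m)]
      have hTinj : Function.Injective T := by
        refine (injective_iff_map_eq_zero T).mpr fun m hm => ?_
        have hm' : m = s (pr m) := sub_eq_zero.mp hm
        have h0 : pr m = 0 := by
          refine eq_zero_of_invariant_matrix p hP (fun x y => (if x = y then 1 else 0) - a x y)
            (fun g x y => by simp [ha]) ⟨o, MulAction.mem_orbit_self o⟩ ?_ (pr m) fun y => ?_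
          · rw [Finset.sum_sub_distrib, hc]
            simp
          · simp only [sub_mul, Finset.sum_sub_distrib, ← hprs, ← hm']
            simp
        rw [hm', h0, map_zero]
      -- Precomposing the remaining functionals with $T^{-1}$ restores the frame identity, because
      -- `T` is the partial sum over the complement of `O`.
      let e := LinearEquiv.ofInjectiveEndo T hTinj
      have he : ∀ m, T (e.symm m) = m := fun m => e.apply_symm_apply m
      have heρ : ∀ g m, e.symm (ρ g m) = ρ g (e.symm m) := fun g m => hTinj (by
        rw [he, hTρ, he])
      refine ih _ hcard ρ ⟨{ω // ω ∉ O}, inferInstance, inferInstance, fun ω => r ω,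
        fun ω => i ω ∘ₗ e.symm.toLinearMap, rfl, fun g ω => hr g ω, fun g ω m => ?_, fun m => ?_⟩
      · change i (g • (ω : Ω)) (e.symm (ρ g m)) = i ω (e.symm m)
        rw [heρ, hi]
      · exact (hT (e.symm m)).symm.trans (he m)
    · have hinj : Function.Injective (pr ∘ₗ s) := by
        refine (injective_iff_map_eq_zero (pr ∘ₗ s)).mpr fun x hx => ?_
        refine eq_zero_of_invariant_matrix p hP a ha _ hc x fun y => ?_
        rw [← hprs]
        exact congrFun hx y
      let e := LinearEquiv.ofInjectiveEndo (pr ∘ₗ s) hinj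
      have he : ∀ x, pr (s (e.symm x)) = x := fun x => e.apply_symm_apply x
      have he' : ∀ x, e.symm (pr (s x)) = x := fun x => e.symm_apply_apply x
      -- A left inverse of `s`; thus $M$ is the direct sum of $\ker$ `pr` and the image of `s`, and
      -- the projected frame without `O` is a frame of $\ker$ `pr`.
      let q : M →ₗ[k] (O → k) := e.symm.toLinearMap ∘ₗ pr
      have hq : ∀ m, q m = e.symm (pr m) := fun _ => rfl
      have hsq : ∀ g m, s (q (ρ g m)) = ρ g (s (q m)) := by
        intro g m
        refine hsρ g _ _ fun y => ?_
        let x' : O → k := fun y => q (ρ g m) (g • y)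
        suffices h : x' = q m from congrFun h y
        refine hinj (funext fun y => ?_)
        have h1 : s (q (ρ g m)) = ρ g (s x') := hsρ g x' _ fun _ => rfl
        change pr (s x') y = pr (s (q m)) y
        rw [← hprρ g, ← h1, hq, hq, he, he, hprρ]
      let M' : Submodule k M := LinearMap.ker pr
      have hM' : ∀ g, ∀ m ∈ M', ρ g m ∈ M' := by
        intro g m hm
        refine LinearMap.mem_ker.mpr (funext fun y => ?_)
        have h := hprρ g m (g⁻¹ • y)
        rw [smul_inv_smul, LinearMap.mem_ker.mp hm] at h
        exact h
      let π : M →ₗ[k] M' := (LinearMap.id - s ∘ₗ q).codRestrict M' fun m => by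
        refine LinearMap.mem_ker.mpr ?_
        change pr (m - s (q m)) = 0
        rw [map_sub, hq, he, sub_self]
      have hπ : ∀ m, (π m : M) = m - s (q m) := fun _ => rfl
      let ρ' : Representation k P M' :=
        { toFun := fun g => (ρ g).restrict (hM' g)
          map_one' := by ext; simp
          map_mul' := fun g h => by ext; simp }
      have hρ' : ∀ g m, ((ρ' g m : M') : M) = ρ g m := fun _ _ => rfl
      have hframe : HasFrame ρ' (Fintype.card {ω // ω ∉ O}) := by
        refine ⟨{ω // ω ∉ O}, inferInstance, inferInstance, fun ω => π (r ω), fun ω => i ω ∘ₗ M'.subtype,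
          rfl, fun g ω => ?_, fun g ω m => hi g ω m, fun m => ?_⟩
        · refine Subtype.ext ?_
          rw [hρ', hπ, hπ, hcoe, hr, hsq, map_sub]
        · have h1 := hsplit m
          rw [LinearMap.mem_ker.mp m.2, map_zero, zero_add] at h1
          have h2 := congrArg π h1
          rw [map_sum] at h2
          simp only [map_smul] at h2
          refine h2.trans (Subtype.ext ?_)
          rw [hπ, hq, LinearMap.mem_ker.mp m.2]
          simp
      obtain ⟨ι, _, b, hb⟩ := ih _ hcard ρ' hframe
      let E : (M' × (O → k)) ≃ₗ[k] M := LinearEquiv.ofLinearMap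
        (M'.subtype.coprod s) (π.prod q)
        (LinearMap.ext fun m => by
          change (π m : M) + s (q m) = m
          rw [hπ, sub_add_cancel])
        (LinearMap.ext fun ⟨m, x⟩ => by
          have hqm : q (m + s x) = x := by
            rw [hq, map_add, LinearMap.mem_ker.mp m.2, zero_add, he']
          refine Prod.ext (Subtype.ext ?_) hqm
          change ((π ((m : M) + s x) : M') : M) = m
          rw [hπ, hqm, add_sub_cancel_right])
      have hE : ∀ m x, E (m, x) = (m : M) + s x := fun _ _ => rfl
      refine ⟨ι ⊕ O, inferInstance, (b.prod (Pi.basisFun k O)).map E, ?_⟩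
      rintro g (x | y)
      · obtain ⟨j, hj⟩ := hb g x
        refine ⟨Sum.inl j, ?_⟩
        simp only [Module.Basis.map_apply, Module.Basis.prod_apply, Sum.elim_inl,
          Function.comp_apply, LinearMap.inl_apply, hE, map_zero, add_zero]
        rw [← hj, hρ']
      · refine ⟨Sum.inr (g • y), ?_⟩
        have hsy : ∀ y : O, s (Pi.single y 1) = r y := fun y => by
          simp [s]
        simp only [Module.Basis.map_apply, Module.Basis.prod_apply, Sum.elim_inr,
          Function.comp_apply, LinearMap.inr_apply, hE, Pi.basisFun_apply, hsy]
        rw [ZeroMemClass.coe_zero, zero_add, zero_add]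
        exact (hr g y).symm

/-! ### Closure of $p$-permutation modules under retracts. -/

section PermutationBasis

variable {k G : Type u} [Field k] [Group G]

theorem IsPermutation.exists_mulAction {M : Rep.{u} k G} (hM : IsPermutation M) :
    ∃ (n : ℕ) (b : Module.Basis (Fin n) k M) (_ : MulAction G (Fin n)),
      ∀ (g : G) (i : Fin n), M.ρ g (b i) = b (g • i) := by
  obtain ⟨n, b, hb⟩ := hM
  choose σ hσ using hb
  exact ⟨n, b, { smul := σ, one_smul := fun i => b.injective ((hσ 1 i).symm.trans (by simp)),
                 mul_smul := fun g h i => b.injective ((hσ (g * h) i).symm.trans (by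
                  rw [map_mul, Module.End.mul_apply, hσ h i]
                  exact hσ g (σ h i))) }, hσ⟩

theorem coord_smul_apply {M : Rep.{u} k G} {ι : Type*} [MulAction G ι]
    (b : Module.Basis ι k M) (hb : ∀ (g : G) (i : ι), M.ρ g (b i) = b (g • i)) (g : G) (i : ι)
    (m : M) : b.coord (g • i) (M.ρ g m) = b.coord i m := by
  classical
  suffices h : b.coord (g • i) ∘ₗ M.ρ g = b.coord i from LinearMap.congr_fun h m
  refine b.ext fun j => ?_
  rw [LinearMap.comp_apply, hb]
  simp [Finsupp.single_apply]

theorem IsPermutation.finite {M : Rep.{u} k G} (hM : IsPermutation M) : Module.Finite k M := by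
  obtain ⟨n, b, -⟩ := hM
  exact Module.Finite.of_basis b

theorem IsPPermutation.finite {p : ℕ} {M : Rep.{u} k G} (hM : IsPPermutation p M) :
    Module.Finite k M :=
  (hM ⊥ IsPGroup.of_bot).finite

theorem IsPPermutation.of_retract [Finite G] {p : ℕ} [Fact p.Prime] [CharP k p]
    {M N : Rep.{u} k G} (hM : IsPPermutation p M) (r : Retract N M) : IsPPermutation p N := by
  intro P hP
  obtain ⟨n, b, _, hb⟩ := (hM P hP).exists_mulAction
  -- The frame consists of the projected basis vectors of $M$ and the restricted coordinate
  -- functions.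
  have hframe : HasFrame (Rep.res P.subtype N).ρ n := by
    refine ⟨Fin n, inferInstance, inferInstance, fun i => r.r.hom (b i),
      fun i => b.coord i ∘ₗ r.i.hom.toLinearMap, Fintype.card_fin n, fun g i => ?_,
      fun g i m => ?_, fun m => ?_⟩
    · change r.r.hom (b (g • i)) = _
      rw [← hb]
      exact Rep.hom_comm_apply r.r (g : G) (b i)
    · change b.coord (g • i) (r.i.hom (N.ρ (g : G) m)) = b.coord i (r.i.hom m)
      rw [Rep.hom_comm_apply r.i (g : G) m]
      exact coord_smul_apply b hb g i _
    · have h1 : ∑ i, b.coord i (r.i.hom m) • b i = r.i.hom m := b.sum_repr (r.i.hom m)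
      have h2 := congrArg r.r.hom.toLinearMap h1
      rw [map_sum] at h2
      simp only [map_smul] at h2
      exact h2.trans (congrArg (fun f : N ⟶ N => f.hom m) r.retract)
  obtain ⟨ι, _, c, hc⟩ := HasFrame.hasPermutedBasis p hP n _ hframe
  refine ⟨Fintype.card ι, c.reindex (Fintype.equivFin ι), fun g i => ?_⟩
  obtain ⟨j, hj⟩ := hc g ((Fintype.equivFin ι).symm i)
  exact ⟨Fintype.equivFin ι j, by simpa using hj⟩

end PermutationBasis

/-! ### Complexes of least total dimension in a homotopy class. -/

section MinimalComplexes

variable {k G : Type u} [Field k] [Group G]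

theorem complex_pow_f (D : ChainComplex (Rep.{u} k G) ℤ) (f : End D) (n : ℕ) (j : ℤ) :
    (f ^ n : End D).f j = ((show End (D.X j) from HomologicalComplex.Hom.f f j) ^ n : End (D.X j)) := by
  induction n with
  | zero => rfl
  | succ n ih =>
    rw [pow_succ, pow_succ, End.mul_def, End.mul_def, HomologicalComplex.comp_f, ih]

theorem homotopy_pow (D : ChainComplex (Rep.{u} k G) ℤ) (f : End D) (h : Homotopy f (𝟙 D))
    (n : ℕ) : Nonempty (Homotopy (f ^ n : End D) (𝟙 D)) := by
  induction n with
  | zero => exact ⟨Homotopy.refl _⟩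
  | succ n ih =>
    obtain ⟨h'⟩ := ih
    exact ⟨(h.comp h').trans (Homotopy.ofEq (Category.comp_id _))⟩

/-- The total dimension of a complex. -/
noncomputable def totalDim (D : ChainComplex (Rep.{u} k G) ℤ) : ℕ :=
  ∑ᶠ i, Module.finrank k (D.X i)

theorem totalDim_eq_sum {D : ChainComplex (Rep.{u} k G) ℤ} {a b : ℤ}
    (h : ∀ i : ℤ, i < a ∨ b < i → IsZero (D.X i)) :
    totalDim D = ∑ i ∈ Finset.Icc a b, Module.finrank k (D.X i) := by
  refine finsum_eq_sum_of_support_subset _ fun i hi => ?_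
  by_contra hn
  refine hi ?_
  have := (Rep.isZero_iff (k := k) G _).mp (h i (by
    rw [Finset.coe_Icc, Set.mem_Icc] at hn
    omega))
  exact Module.finrank_zero_of_subsingleton

theorem finrank_le_totalDim {D : ChainComplex (Rep.{u} k G) ℤ} (hD : IsBounded D) (i : ℤ) :
    Module.finrank k (D.X i) ≤ totalDim D := by
  obtain ⟨a, b, h⟩ := hD
  rw [totalDim_eq_sum h]
  by_cases hi : i ∈ Finset.Icc a b
  · exact Finset.single_le_sum (f := fun i => Module.finrank k (D.X i)) (fun _ _ => Nat.zero_le _) hi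
  · have := (Rep.isZero_iff (k := k) G _).mp (h i (by rw [Finset.mem_Icc] at hi; omega))
    rw [Module.finrank_zero_of_subsingleton]
    exact Nat.zero_le _

/-- Fitting's lemma for an endomorphism homotopic to the identity of a bounded complex of finite
dimensional modules: a complex of smallest total dimension in its homotopy class, among those
whose terms are retracts of its terms, has no non-invertible such endomorphism. -/
theorem isIso_of_homotopy_id {D : ChainComplex (Rep.{u} k G) ℤ} (hD : IsBounded D)
    (hfin : ∀ i, Module.Finite k (D.X i))
    (hmin : ∀ E : ChainComplex (Rep.{u} k G) ℤ, (∀ i, Nonempty (Retract (E.X i) (D.X i))) →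
      Nonempty (HomotopyEquiv D E) → totalDim D ≤ totalDim E)
    (f : D ⟶ D) (h : Homotopy f (𝟙 D)) : IsIso f := by
  let f' : End D := f
  -- A single exponent beyond the dimension of every term, so that kernels stabilize in all degrees
  -- at once.
  let n := totalDim D + 1
  let F : D ⟶ D := f' ^ n
  obtain ⟨hF⟩ : Nonempty (Homotopy F (𝟙 D)) := homotopy_pow D f' h n
  obtain ⟨E, q, i, hqe, him, hfac⟩ : ∃ (E : ChainComplex (Rep.{u} k G) ℤ) (q : D ⟶ E) (i : E ⟶ D),
      Epi q ∧ Mono i ∧ q ≫ i = F :=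
    ⟨_, Abelian.factorThruImage F, Abelian.image.ι F, inferInstance, inferInstance,
      Abelian.image.fac F⟩
  have hiso : ∀ j, IsIso ((i ≫ q).f j) := by
    intro j
    rw [HomologicalComplex.comp_f]
    have : Epi (q.f j) := inferInstance
    have : Mono (i.f j) := inferInstance
    refine isIso_of_factorization (F.f j) (q.f j) (i.f j) (by rw [← hfac]; rfl) fun x hx => ?_
    have hp : F.f j = ((show End (D.X j) from f.f j) ^ n : End (D.X j)) := complex_pow_f D f' n j
    rw [hp] at hx ⊢
    exact end_pow_pow_eq_zero _ ((finrank_le_totalDim hD j).trans (Nat.le_succ _)) x hx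
  have hiq : IsIso (i ≫ q) := HomologicalComplex.Hom.isIso_of_components _
  -- Put $F=iq$ (maps composed on the right, `q` first) between `i` on one side and `q` followed by
  -- the inverse of `i ≫ q` on the other: $F$ yields `i ≫ q`, and $1$ yields the identity.
  have h2 : Homotopy (i ≫ q) (𝟙 _) := by
    have h1 := ((hF.compLeft i).compRight q).compRight (inv (i ≫ q))
    refine (Homotopy.ofEq ?_).trans (h1.trans (Homotopy.ofEq ?_))
    · rw [← hfac]
      simp only [Category.assoc]
      rw [← Category.assoc i q (inv (i ≫ q)), IsIso.hom_inv_id, Category.comp_id]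
    · rw [Category.comp_id, IsIso.hom_inv_id]
  let e : HomotopyEquiv D E :=
    { hom := q
      inv := i
      homotopyHomInvId := (Homotopy.ofEq hfac).trans hF
      homotopyInvHomId := h2 }
  let r : ∀ j, Retract (E.X j) (D.X j) := fun j =>
    ⟨i.f j, q.f j ≫ inv ((i ≫ q).f j), by
      rw [← Category.assoc, ← HomologicalComplex.comp_f, IsIso.hom_inv_id]⟩
  have hle := hmin _ (fun j => ⟨r j⟩) ⟨e⟩
  have hrank : ∀ j, Module.finrank k (E.X j) ≤ Module.finrank k (D.X j) :=
    fun j => LinearMap.finrank_le_finrank_of_injective (f := (r j).i.hom.toLinearMap)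
      (injective_of_retract (r j))
  obtain ⟨a, b, hab⟩ := hD
  have hab' : ∀ j : ℤ, j < a ∨ b < j → IsZero (E.X j) := fun j hj => by
    have := (Rep.isZero_iff (k := k) G _).mp (hab j hj)
    exact (Rep.isZero_iff (k := k) G _).mpr (injective_of_retract (r j)).subsingleton
  rw [totalDim_eq_sum hab, totalDim_eq_sum hab'] at hle
  -- Minimality forces equal dimensions degreewise, so the image of $F$ is all of `D`.
  have heq := (Finset.sum_eq_sum_iff_of_le fun j _ => hrank j).mp
    (le_antisymm (Finset.sum_le_sum fun j _ => hrank j) hle)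
  have hi : ∀ j, IsIso (i.f j) := by
    intro j
    have hj : Module.finrank k (E.X j) = Module.finrank k (D.X j) := by
      by_cases hj : j ∈ Finset.Icc a b
      · exact heq j hj
      · have hj' : j < a ∨ b < j := by rw [Finset.mem_Icc] at hj; omega
        have := (Rep.isZero_iff (k := k) G _).mp (hab j hj')
        have := (Rep.isZero_iff (k := k) G _).mp (hab' j hj')
        rw [Module.finrank_zero_of_subsingleton, Module.finrank_zero_of_subsingleton]
    have := finite_of_retract (r j)
    exact isIso_of_bijective _ ⟨injective_of_retract (r j),
      (LinearMap.injective_iff_surjective_of_finrank_eq_finrank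
        (f := (r j).i.hom.toLinearMap) hj).mp (injective_of_retract (r j))⟩
  have hi' : IsIso i := HomologicalComplex.Hom.isIso_of_components _
  have hq : IsIso q := IsIso.of_isIso_comp_left i q
  have hFi : IsIso F := by rw [← hfac]; infer_instance
  have hu : IsUnit (f' ^ n) := (isUnit_iff_isIso _).mpr hFi
  exact (isUnit_iff_isIso _).mp ((isUnit_pow_iff (Nat.succ_ne_zero _)).mp hu)

/-- A bounded complex of `p`-permutation modules is homotopy equivalent to one all of whose
endomorphisms homotopic to the identity are isomorphisms. -/
theorem exists_minimal_complex [Finite G] (p : ℕ) [Fact p.Prime] [CharP k p]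
    (C : ChainComplex (Rep.{u} k G) ℤ) (hC : IsBounded C) (hCp : ∀ i, IsPPermutation p (C.X i)) :
    ∃ D : ChainComplex (Rep.{u} k G) ℤ, IsBounded D ∧ (∀ i, IsPPermutation p (D.X i)) ∧
      Nonempty (HomotopyEquiv C D) ∧ ∀ f : D ⟶ D, Homotopy f (𝟙 D) → IsIso f := by
  let S : Set (ChainComplex (Rep.{u} k G) ℤ) :=
    {D | IsBounded D ∧ (∀ i, IsPPermutation p (D.X i)) ∧ Nonempty (HomotopyEquiv C D)}
  obtain ⟨D, ⟨hD, hDp, ⟨e⟩⟩, hmin⟩ := (InvImage.wf (totalDim (k := k) (G := G))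
    Nat.lt_wfRel.wf).has_min S ⟨C, hC, hCp, ⟨HomotopyEquiv.refl C⟩⟩
  refine ⟨D, hD, hDp, ⟨e⟩, isIso_of_homotopy_id hD (fun i => (hDp i).finite) ?_⟩
  rintro E hE ⟨e'⟩
  refine not_lt.mp (hmin E ⟨?_, fun i => (hDp i).of_retract (hE i).some, ⟨e.trans e'⟩⟩)
  obtain ⟨a, b, hab⟩ := hD
  refine ⟨a, b, fun i hi => ?_⟩
  have := (Rep.isZero_iff (k := k) G _).mp (hab i hi)
  exact (Rep.isZero_iff (k := k) G _).mpr (injective_of_retract (hE i).some).subsingleton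

end MinimalComplexes

/-! ### Removing one conjugacy class in one degree. -/

section Reduction

variable {k G : Type u} [Field k] [Group G] [Finite G]

theorem acyclic_of_homotopyEquiv {C D : ChainComplex (Rep.{u} k G) ℤ} (e : HomotopyEquiv C D)
    {P : Subgroup G} (hC : (brauerComplex C P).Acyclic) : (brauerComplex D P).Acyclic := by
  let e' := (brauerFunctor k P).mapHomotopyEquiv e
  intro i
  rw [HomologicalComplex.exactAt_iff_isZero_homology]
  exact ((HomologicalComplex.exactAt_iff_isZero_homology _ _).mp (hC i)).of_iso
    (e'.toHomologyIso i).symm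

theorem acyclic_of_isTraceProjective {D : ChainComplex (Rep.{u} k G) ℤ} {Y : Set (Subgroup G)}
    {P : Subgroup G} (hY : ∀ H ∈ Y, ∀ g : G, ¬ P ≤ H.map (MulAut.conj g).toMonoidHom)
    (hD : ∀ i, IsTraceProjective Y (D.X i)) : (brauerComplex D P).Acyclic :=
  fun i => ShortComplex.exact_of_isZero_X₂ _ ((hD i).isZero_brauer hY)

/-- If the map on Brauer quotients induced by `d : N → M` is surjective and `M` is a permutation
`P`-module, then `d` has a `P`-equivariant section modulo proper traces. -/
theorem exists_section_modulo_traceSum {M N : Rep.{u} k G} (d : N ⟶ M) {P : Subgroup G}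
    (hM : IsPermutation (Rep.res P.subtype M))
    (hd : ∀ m : fixedPoints M P, ∃ n : fixedPoints N P, m - fixedPointsMap d P n ∈ traceSum M P) :
    ∃ s ∈ fixedPoints (homRep M N) P, ∃ t ∈ traceSum (homRep M M) P,
      (t : M →ₗ[k] M) = LinearMap.id - d.hom.toLinearMap ∘ₗ s := by
  classical
  obtain ⟨n, b', _, hb'⟩ := hM.exists_mulAction
  let b : Module.Basis (Fin n) k M := b'
  have hb : ∀ (g : P) (i : Fin n), M.ρ (g : G) (b i) = b (g • i) := hb'
  have hcoord : ∀ (g : P) (i : Fin n) (m : M), b.coord (g • i) (M.ρ (g : G) m) = b.coord i m :=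
    fun g i m => coord_smul_apply b' hb' g i m
  let fixed (i : Fin n) : Prop := ∀ g : P, g • i = i
  have hfix : ∀ i, fixed i → b i ∈ fixedPoints M P := fun i hi g =>
    (hb g i).trans (congrArg b (hi g))
  have hsmul : ∀ (g : P) i, fixed (g • i) ↔ fixed i := by
    intro g i
    constructor
    · intro h
      have h1 := h g⁻¹
      rw [inv_smul_smul] at h1
      rwa [← h1] at h
    · intro h
      rwa [h g]
  choose ν hν using fun i : {i // fixed i} => hd ⟨b i, hfix i i.2⟩
  -- Basis vectors moved by $P$ may go to $0$: their part of the identity is already a sum of proper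
  -- traces.
  let s : M →ₗ[k] N := b.constr k fun i => if h : fixed i then (ν ⟨i, h⟩ : N) else 0
  have hs : ∀ i, s (b i) = if h : fixed i then (ν ⟨i, h⟩ : N) else 0 := fun i =>
    b.constr_basis k _ i
  have hsfix : s ∈ fixedPoints (homRep M N) P := by
    refine mem_fixedPoints_homRep.mpr fun g hg m => ?_
    suffices h : s ∘ₗ M.ρ g = N.ρ g ∘ₗ s from LinearMap.congr_fun h m
    refine b.ext fun i => ?_
    rw [LinearMap.comp_apply, LinearMap.comp_apply, hb ⟨g, hg⟩ i]
    by_cases hi : fixed i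
    · rw [hi, hs, dif_pos hi]
      exact (apply_of_mem N hg _).symm
    · rw [hs, hs, dif_neg hi, dif_neg (mt (hsmul _ i).mp hi), map_zero]
  -- The coordinate of a fixed basis vector is $P$-invariant, so tensoring with it turns the proper
  -- traces for `hν` into proper traces in $\operatorname{End}_k(M)$.
  have h1 : ∀ i : {i // fixed i}, ∃ t ∈ traceSum (homRep M M) P, (t : M →ₗ[k] M) =
      (b.coord i).smulRight (b i - d.hom.toLinearMap (ν i)) := by
    intro i
    have heq : ∀ g ∈ P, ∀ m, (LinearMap.smulRightₗ (M := M) (M₂ := M) (b.coord i)) (M.ρ g m) =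
        (homRep M M).ρ g (LinearMap.smulRightₗ (M := M) (M₂ := M) (b.coord i) m) := by
      intro g hg m
      refine LinearMap.ext fun x => ?_
      change b.coord i x • M.ρ g m = M.ρ g (b.coord i (M.ρ g⁻¹ x) • m)
      rw [map_smul]
      congr 1
      have h := hcoord ⟨g⁻¹, P.inv_mem hg⟩ i x
      rw [i.2] at h
      exact h.symm
    exact ⟨_, fixedMap_mem_traceSpan (V := M) (W := homRep M M) (P := P) (Y := {Q | Q < P}) _
      (fun Q hQ => le_of_lt hQ) heq (hν i), rfl⟩
  let _ : MulAction P {i // ¬ fixed i} :=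
    { smul := fun g i => ⟨g • (i : Fin n), mt (hsmul g i).mp i.2⟩
      one_smul := fun i => Subtype.ext (one_smul P (i : Fin n))
      mul_smul := fun g h i => Subtype.ext (mul_smul g h (i : Fin n)) }
  obtain ⟨t₂, ht₂, ht₂e⟩ := finsum_mem_traceSum (homRep M M) P
    (fun i : {i // ¬ fixed i} => (b.coord i).smulRight (b i)) (fun g i => by
      refine LinearMap.ext fun x => ?_
      change b.coord (g • (i : Fin n)) x • b (g • (i : Fin n)) =
        M.ρ (g : G) (b.coord i (M.ρ (g : G)⁻¹ x) • b i)
      rw [LinearMap.map_smul, hb]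
      congr 1
      rw [← hcoord g i (M.ρ (g : G)⁻¹ x)]
      simp) (fun i => by
      by_contra! hc
      exact i.2 fun g => congrArg Subtype.val (hc g))
  choose t₁ ht₁ ht₁e using h1
  refine ⟨s, hsfix, ∑ i, t₁ i + t₂, Submodule.add_mem _ (Submodule.sum_mem _ fun i _ => ht₁ i) ht₂,
    ?_⟩
  rw [Submodule.coe_add, Submodule.coe_sum, ht₂e, finsum_eq_sum_of_fintype]
  simp only [ht₁e]
  refine b.ext fun j => ?_
  have hval : (∑ i : {i // fixed i}, (b.coord i).smulRight (b i - d.hom.toLinearMap (ν i)) +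
      ∑ i : {i // ¬ fixed i}, (b.coord i).smulRight (b i) : M →ₗ[k] M) (b j) =
      ∑ i : {i // fixed i}, b.coord i (b j) • (b i - d.hom.toLinearMap (ν i)) +
        ∑ i : {i // ¬ fixed i}, b.coord i (b j) • b i := by
    rw [LinearMap.add_apply, LinearMap.sum_apply, LinearMap.sum_apply]
    rfl
  refine hval.trans ?_
  rw [LinearMap.sub_apply, LinearMap.comp_apply, hs, LinearMap.id_apply]
  simp only [Module.Basis.coord_apply, Module.Basis.repr_self, Finsupp.single_apply]
  by_cases hj : fixed j
  · rw [dif_pos hj, Finset.sum_eq_single ⟨j, hj⟩, Finset.sum_eq_zero]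
    · simp
    · intro i _
      rw [if_neg (show ¬ j = (i : Fin n) from fun h => i.2 (h ▸ hj)), zero_smul]
    · intro i _ hi
      rw [if_neg (fun h => hi (Subtype.ext h.symm)), zero_smul]
    · simp
  · rw [dif_neg hj, Finset.sum_eq_zero, Finset.sum_eq_single ⟨j, hj⟩]
    · simp
    · intro i _ hi
      rw [if_neg (fun h => hi (Subtype.ext h.symm)), zero_smul]
    · simp
    · intro i _
      rw [if_neg (show ¬ j = (i : Fin n) from fun h => hj (h ▸ i.2)), zero_smul]

/-- Acyclicity of the Brauer quotient at the least degree where it can be nonzero gives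
surjectivity of the differential. -/
theorem exists_sub_mem_traceSum {D : ChainComplex (Rep.{u} k G) ℤ} {P : Subgroup G} {n : ℤ}
    (hD : (brauerComplex D P).ExactAt n) (h0 : IsZero ((brauerFunctor k P).obj (D.X (n - 1))))
    (m : fixedPoints (D.X n) P) : ∃ x : fixedPoints (D.X (n + 1)) P,
      m - fixedPointsMap (D.d (n + 1) n) P x ∈ traceSum (D.X n) P := by
  rw [HomologicalComplex.exactAt_iff' _ (n + 1) n (n - 1) (by simp) (by simp),
    ShortComplex.exact_iff_epi _ (h0.eq_of_tgt _ _)] at hD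
  obtain ⟨y, hy⟩ := (Rep.epi_iff_surjective _).mp hD (Submodule.Quotient.mk m)
  obtain ⟨x, rfl⟩ := Submodule.Quotient.mk_surjective _ y
  exact ⟨x, (Submodule.Quotient.eq _).mp hy.symm⟩

/-- Traces from a set `Y` of subgroups, up to conjugation of one of its members. -/
theorem exists_relTrace_add {V : Rep.{u} k G} {Y Y' : Set (Subgroup G)} {P : Subgroup G}
    (hY : ∀ H ∈ Y, H ∈ Y' ∨ ∃ g : G, H = P.map (MulAut.conj g).toMonoidHom)
    {t : fixedPoints V ⊤} (ht : t ∈ traceSpan V ⊤ Y) :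
    ∃ φ : fixedPoints V P, ∃ j ∈ traceSpan V ⊤ Y', t = relTrace V ⊤ P φ + j := by
  have hle : traceSpan V ⊤ Y ≤ LinearMap.range (relTrace V ⊤ P) ⊔ traceSpan V ⊤ Y' := by
    refine iSup₂_le fun H hH => ?_
    rintro _ ⟨m, rfl⟩
    obtain h | ⟨g, rfl⟩ := hY H hH
    · exact Submodule.mem_sup_right (relTrace_mem_traceSpan V ⊤ h m)
    · obtain ⟨w, hw⟩ := exists_relTrace_eq_of_conj V P g m
      exact Submodule.mem_sup_left ⟨w, hw⟩
  obtain ⟨_, ⟨φ, rfl⟩, j, hj, h⟩ := Submodule.mem_sup.mp (hle ht)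
  exact ⟨φ, j, hj, h.symm⟩

/-- One step of the reduction: remove the conjugacy class of `P` at degree `n`. -/
theorem isTraceProjective_of_exactAt {p : ℕ} {D : ChainComplex (Rep.{u} k G) ℤ}
    (hDp : ∀ i, IsPPermutation p (D.X i)) (hmin : ∀ f : D ⟶ D, Homotopy f (𝟙 D) → IsIso f)
    {Y Y' : Set (Subgroup G)} {P : Subgroup G} (hP : IsPGroup p P)
    (hY : ∀ H ∈ Y, H ∈ Y' ∨ ∃ g : G, H = P.map (MulAut.conj g).toMonoidHom)
    (hPY : {Q | Q < P} ⊆ Y') {n : ℤ} (hn : IsTraceProjective Y (D.X n))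
    (hD : (brauerComplex D P).ExactAt n)
    (h0 : IsZero ((brauerFunctor k P).obj (D.X (n - 1)))) : IsTraceProjective Y' (D.X n) := by
  obtain ⟨s, hs, t, ht, hts⟩ := exists_section_modulo_traceSum (D.d (n + 1) n) (hDp n P hP)
    (exists_sub_mem_traceSum hD h0)
  obtain ⟨τ, hτ, hτ1⟩ := hn
  obtain ⟨φ, j, hj, rfl⟩ := exists_relTrace_add hY hτ
  let d := (D.d (n + 1) n).hom.toLinearMap
  have hφ := mem_fixedPoints_homRep.mp φ.2
  obtain ⟨tφ, htφ, htφe⟩ := mem_traceSpan_comp (L := D.X n) (fun Q hQ => le_of_lt hQ)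
    (φ : D.X n →ₗ[k] D.X n) hφ ht
  let sφ : fixedPoints (homRep (D.X n) (D.X (n + 1))) P :=
    ⟨s ∘ₗ (φ : D.X n →ₗ[k] D.X n), mem_fixedPoints_homRep.mpr fun g hg m => by
      rw [LinearMap.comp_apply, hφ g hg, mem_fixedPoints_homRep.mp hs g hg]
      rfl⟩
  let h : D.X n ⟶ D.X (n + 1) := homOfFixed (relTrace _ ⊤ P sφ)
  -- From $ds=1-t$ comes $d\,s\varphi=\varphi-t\varphi$; taking traces gives
  -- $dh=\operatorname{tr}_P^G(\varphi)-\operatorname{tr}_P^G(t\varphi)$.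
  have hdh := comp_relTrace le_top d (hom_equivariant (D.d (n + 1) n) ⊤) sφ (φ - tφ) (by
    rw [Submodule.coe_sub, htφe, hts]
    refine LinearMap.ext fun m => ?_
    simp [sφ, d])
  have hmem : relTrace _ ⊤ P tφ + j ∈ traceSpan (homRep (D.X n) (D.X n)) ⊤ Y' :=
    Submodule.add_mem _ (relTrace_mem_of_mem_traceSpan _ le_top (fun Q hQ => le_of_lt hQ) hPY htφ) hj
  -- A homotopy supported on $D_n\to D_{n+1}$ alone, so that in degree $n$ only the term $dh$
  -- occurs.
  let H : ∀ i j : ℤ, (ComplexShape.down ℤ).Rel j i → (D.X i ⟶ D.X j) := fun i j _ =>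
    if hi : i = n ∧ j = n + 1 then
      eqToHom (by rw [hi.1]) ≫ h ≫ eqToHom (by rw [hi.2]) else 0
  let f : D ⟶ D := 𝟙 D - Homotopy.nullHomotopicMap' H
  have hf : Homotopy f (𝟙 D) :=
    (Homotopy.equivSubZero.symm ((Homotopy.ofEq (sub_sub_cancel _ _)).trans
      (Homotopy.nullHomotopy' H))).symm
  have hfn : f.f n = homOfFixed (relTrace _ ⊤ P tφ + j) := by
    have h1 : (Homotopy.nullHomotopicMap' H).f n = h ≫ D.d (n + 1) n := by
      rw [Homotopy.nullHomotopicMap'_f (k₂ := n + 1) (k₁ := n) (k₀ := n - 1) rfl (by simp)]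
      simp [H]
    have h2 : f.f n = 𝟙 _ - h ≫ D.d (n + 1) n := by
      rw [← h1]
      rfl
    rw [h2]
    ext m
    have h3 := LinearMap.congr_fun hτ1 m
    have h4 := LinearMap.congr_fun hdh m
    rw [map_sub] at h4
    change m - d ((relTrace _ ⊤ P sφ : D.X n →ₗ[k] D.X (n + 1)) m) =
      (relTrace _ ⊤ P tφ : D.X n →ₗ[k] D.X n) m + (j : D.X n →ₗ[k] D.X n) m
    change (relTrace _ ⊤ P φ : D.X n →ₗ[k] D.X n) m + (j : D.X n →ₗ[k] D.X n) m = m at h3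
    change (relTrace _ ⊤ P φ : D.X n →ₗ[k] D.X n) m - (relTrace _ ⊤ P tφ : D.X n →ₗ[k] D.X n) m =
      d ((relTrace _ ⊤ P sφ : D.X n →ₗ[k] D.X (n + 1)) m) at h4
    rw [← h4]
    nth_rewrite 1 [← h3]
    abel
  have hiso : IsIso f := hmin f hf
  have hison : IsIso (f.f n) := inferInstance
  rw [hfn] at hison
  let w := inv (homOfFixed (relTrace _ ⊤ P tφ + j))
  obtain ⟨r, hr, hre⟩ := comp_mem_traceSpan (fun _ _ => le_top) w.hom.toLinearMap
    (hom_equivariant w ⊤) hmem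
  refine ⟨r, hr, hre.trans ?_⟩
  exact congrArg (fun f : D.X n ⟶ D.X n => f.hom.toLinearMap)
    (IsIso.hom_inv_id (homOfFixed (relTrace _ ⊤ P tφ + j)))

end Reduction

/-! ### Closed families and the descent to $\mathcal X$. -/

section Main

variable {k G : Type u} [Field k] [Group G]

theorem map_conj_le_iff {P Q : Subgroup G} {g : G} :
    P ≤ Q.map (MulAut.conj g).toMonoidHom ↔ P.map (MulAut.conj g⁻¹).toMonoidHom ≤ Q := by
  constructor
  · rintro h _ ⟨x, hx, rfl⟩
    obtain ⟨y, hy, hyx⟩ := h hx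
    rw [← hyx]
    simpa [mul_assoc] using hy
  · intro h x hx
    exact ⟨_, h ⟨x, hx, rfl⟩, by simp [mul_assoc]⟩

/-- A set of `p`-subgroups closed under conjugation and taking subgroups. -/
structure IsClosedFamily (p : ℕ) (X : Set (Subgroup G)) : Prop where
  isPGroup : ∀ P ∈ X, IsPGroup p P
  conj_mem : ∀ P ∈ X, ∀ g : G, P.map (MulAut.conj g).toMonoidHom ∈ X
  mem_of_le : ∀ P ∈ X, ∀ Q : Subgroup G, Q ≤ P → Q ∈ X

theorem isClosedFamily_isPGroup (p : ℕ) : IsClosedFamily p {P : Subgroup G | IsPGroup p P} where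
  isPGroup _ h := h
  conj_mem _ h _ := h.map _
  mem_of_le _ h _ hQ := h.to_le hQ

theorem isClosedFamily_bot (p : ℕ) : IsClosedFamily p {(⊥ : Subgroup G)} where
  isPGroup := by rintro _ rfl; exact IsPGroup.of_bot
  conj_mem := by rintro _ rfl g; exact Subgroup.map_bot _
  mem_of_le := by rintro _ rfl Q hQ; exact le_bot_iff.mp hQ

theorem IsClosedFamily.not_le_conj {p : ℕ} {X : Set (Subgroup G)} (hX : IsClosedFamily p X)
    {P : Subgroup G} (hP : P ∉ X) : ∀ H ∈ X, ∀ g : G, ¬ P ≤ H.map (MulAut.conj g).toMonoidHom :=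
  fun H hH g h => hP (hX.mem_of_le _ (hX.conj_mem H hH g) P h)

/-- Removing the conjugacy class of a maximal member from a closed family. -/
theorem IsClosedFamily.diff_conj {p : ℕ} {Y : Set (Subgroup G)} (hY : IsClosedFamily p Y)
    {P : Subgroup G} (hmax : ∀ Q ∈ Y, P ≤ Q → Q = P) :
    IsClosedFamily p (Y \ {H | ∃ g : G, H = P.map (MulAut.conj g).toMonoidHom}) := by
  have hmap : ∀ (H : Subgroup G) (a b : G), (H.map (MulAut.conj a).toMonoidHom).map
      (MulAut.conj b).toMonoidHom = H.map (MulAut.conj (b * a)).toMonoidHom := by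
    intro H a b
    rw [Subgroup.map_map, map_mul]
    rfl
  have hone : ∀ H : Subgroup G, H.map (MulAut.conj (1 : G)).toMonoidHom = H := by
    intro H
    rw [map_one]
    exact Subgroup.map_id H
  refine ⟨fun Q hQ => hY.isPGroup Q hQ.1, fun Q hQ g => ⟨hY.conj_mem Q hQ.1 g, ?_⟩,
    fun R hR Q hQR => ⟨hY.mem_of_le R hR.1 Q hQR, ?_⟩⟩
  · rintro ⟨h, hh⟩
    refine hQ.2 ⟨g⁻¹ * h, ?_⟩
    rw [← hmap, ← hh, hmap, inv_mul_cancel, hone]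
  · rintro ⟨g, rfl⟩
    refine hR.2 ⟨g, ?_⟩
    have h1 := hmax _ (hY.conj_mem R hR.1 g⁻¹) (by rwa [map_conj_le_iff, inv_inv])
    rw [← h1, hmap, mul_inv_cancel, hone]

variable [Finite G]

/-- The terms of a minimal complex are projective relative to every closed family outside of which
its Brauer quotients are acyclic. -/
theorem isTraceProjective_of_acyclic {p : ℕ} [Fact p.Prime] [CharP k p]
    {D : ChainComplex (Rep.{u} k G) ℤ} (hDb : IsBounded D)
    (hDp : ∀ i, IsPPermutation p (D.X i)) (hmin : ∀ f : D ⟶ D, Homotopy f (𝟙 D) → IsIso f)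
    {X : Set (Subgroup G)} (hX : IsClosedFamily p X)
    (hD : ∀ P : Subgroup G, IsPGroup p P → P ∉ X → (brauerComplex D P).Acyclic) (i : ℤ) :
    IsTraceProjective X (D.X i) := by
  let S : Set (Set (Subgroup G)) :=
    {Y | X ⊆ Y ∧ IsClosedFamily p Y ∧ ∀ i, IsTraceProjective Y (D.X i)}
  -- Choosing a minimal admissible family replaces an induction over conjugacy classes.
  obtain ⟨Y, hY⟩ := (Set.toFinite S).exists_minimal
    ⟨_, hX.isPGroup, isClosedFamily_isPGroup p, fun i => isTraceProjective_sylow p (D.X i)⟩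
  obtain ⟨hXY, hYc, hYD⟩ := hY.prop
  by_cases hYX : Y ⊆ X
  · exact (hYD i).mono hYX
  exfalso
  obtain ⟨P₀, hP₀Y, hP₀X⟩ := Set.not_subset.mp hYX
  obtain ⟨P, hP⟩ := (Set.toFinite (Y \ X)).exists_maximal ⟨P₀, hP₀Y, hP₀X⟩
  obtain ⟨hPY, hPX⟩ := hP.prop
  -- Maximality outside `X` extends to all of `Y`, since anything above `P` also lies outside the
  -- subgroup-closed `X`.
  have hPmax : ∀ Q ∈ Y, P ≤ Q → Q = P := fun Q hQ hPQ =>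
    le_antisymm (hP.le_of_ge ⟨hQ, fun h => hPX (hX.mem_of_le Q h P hPQ)⟩ hPQ) hPQ
  have hYc' := hYc.diff_conj hPmax
  set Y' := Y \ {H | ∃ g : G, H = P.map (MulAut.conj g).toMonoidHom} with hY'
  have hPY' : P ∉ Y' := fun h => h.2 ⟨1, by rw [map_one]; exact (Subgroup.map_id P).symm⟩
  have hXY' : X ⊆ Y' := by
    rintro H hH
    refine ⟨hXY hH, ?_⟩
    rintro ⟨g, rfl⟩
    exact hPX (hX.mem_of_le _ (hX.conj_mem _ hH g⁻¹) P
      (by rw [map_conj_le_iff, inv_inv]))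
  have hlt : {Q | Q < P} ⊆ Y' := by
    intro Q hQ
    refine ⟨hYc.mem_of_le P hPY Q (le_of_lt hQ), ?_⟩
    rintro ⟨g, rfl⟩
    have h1 : Nat.card (P.map (MulAut.conj g).toMonoidHom) = Nat.card P :=
      Subgroup.card_map_of_injective (MulAut.conj g).injective
    exact (ne_of_lt hQ) (Subgroup.eq_of_le_of_card_ge (le_of_lt hQ) h1.ge)
  have hall : ∀ i, IsTraceProjective Y' (D.X i) := by
    by_contra! hc
    obtain ⟨a, b, hab⟩ := hDb
    -- Boundedness below provides the least bad degree; the term just beneath it is then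
    -- `Y'`-projective and has zero Brauer quotient at `P`.
    obtain ⟨n, hn, hleast⟩ := Int.exists_least_of_bdd
      (P := fun i => ¬ IsTraceProjective Y' (D.X i))
      ⟨a, fun z hz => by
        by_contra hlt
        exact hz (isTraceProjective_of_isZero (hab z (Or.inl (not_le.mp hlt))))⟩ hc
    have hprev : IsTraceProjective Y' (D.X (n - 1)) := by
      by_contra h
      have := hleast _ h
      omega
    refine hn (isTraceProjective_of_exactAt hDp hmin (hYc.isPGroup P hPY) (fun H hH => ?_) hlt
      (hYD n) (hD P (hYc.isPGroup P hPY) hPX n) (hprev.isZero_brauer (hYc'.not_le_conj hPY')))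
    by_cases h : ∃ g : G, H = P.map (MulAut.conj g).toMonoidHom
    · exact Or.inr h
    · exact Or.inl ⟨hH, h⟩
  exact hPY' (hY.le_of_le ⟨hXY', hYc', hall⟩ Set.sdiff_subset hPY)

theorem brauer_acyclic_tfae (p : ℕ) [Fact p.Prime] [CharP k p]
    (C : ChainComplex (Rep.{u} k G) ℤ) (hC : IsBounded C)
    (hCp : ∀ i : ℤ, IsPPermutation p (C.X i)) {X : Set (Subgroup G)} (hX : IsClosedFamily p X) :
    List.TFAE [
      ∀ P : Subgroup G, IsPGroup p P → P ∉ X → (brauerComplex C P).Acyclic,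
      ∃ D : ChainComplex (Rep.{u} k G) ℤ, (∀ i : ℤ, Module.Finite k (D.X i)) ∧
        Nonempty (HomotopyEquiv C D) ∧ ∀ i : ℤ, IsSetProjective X (D.X i),
      ∃ D : ChainComplex (Rep.{u} k G) ℤ, IsBounded D ∧ (∀ i : ℤ, IsPPermutation p (D.X i)) ∧
        Nonempty (HomotopyEquiv C D) ∧ ∀ i : ℤ, IsSetProjective X (D.X i)] := by
  tfae_have 1 → 3 := by
    intro h
    obtain ⟨D, hD, hDp, ⟨e⟩, hmin⟩ := exists_minimal_complex p C hC hCp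
    refine ⟨D, hD, hDp, ⟨e⟩, fun i => ?_⟩
    have := (hDp i).finite
    exact isSetProjective_iff.mpr (isTraceProjective_of_acyclic hD hDp hmin hX
      (fun P hP hPX => acyclic_of_homotopyEquiv e (h P hP hPX)) i)
  tfae_have 3 → 2 := by
    rintro ⟨D, _, hDp, e, h⟩
    exact ⟨D, fun i => (hDp i).finite, e, h⟩
  tfae_have 2 → 1 := by
    rintro ⟨D, hfin, ⟨e⟩, h⟩ P _ hPX
    -- Every term of $D(P)$ is zero, so `D` need not be bounded.
    exact acyclic_of_homotopyEquiv e.symm (acyclic_of_isTraceProjective (hX.not_le_conj hPX)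
      fun i => isSetProjective_iff.mp (h i))
  tfae_finish

end Main

end BoucGeneralization

theorem mainTheorem11 {k G : Type u} [Field k] [Group G] [Finite G] (p : ℕ) [Fact p.Prime]
    [CharP k p] (C : ChainComplex (Rep.{u} k G) ℤ) (hC : BoucGeneralization.IsBounded C)
    (hCp : ∀ i : ℤ, BoucGeneralization.IsPPermutation p (C.X i)) :
    (∀ X : Set (Subgroup G), X.Nonempty →
      (∀ P ∈ X, IsPGroup p P) →
      (∀ P ∈ X, ∀ g : G, P.map (MulAut.conj g).toMonoidHom ∈ X) →
      (∀ P ∈ X, ∀ Q : Subgroup G, Q ≤ P → Q ∈ X) →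
      List.TFAE [
        ∀ P : Subgroup G, IsPGroup p P → P ∉ X →
          (BoucGeneralization.brauerComplex C P).Acyclic,
        ∃ D : ChainComplex (Rep.{u} k G) ℤ, (∀ i : ℤ, Module.Finite k (D.X i)) ∧
          Nonempty (HomotopyEquiv C D) ∧
          ∀ i : ℤ, BoucGeneralization.IsSetProjective X (D.X i),
        ∃ D : ChainComplex (Rep.{u} k G) ℤ, BoucGeneralization.IsBounded D ∧
          (∀ i : ℤ, BoucGeneralization.IsPPermutation p (D.X i)) ∧
          Nonempty (HomotopyEquiv C D) ∧
          ∀ i : ℤ, BoucGeneralization.IsSetProjective X (D.X i)]) ∧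
    List.TFAE [
      ∀ P : Subgroup G, IsPGroup p P → P ≠ ⊥ →
        (BoucGeneralization.brauerComplex C P).Acyclic,
      ∃ D : ChainComplex (Rep.{u} k G) ℤ, (∀ i : ℤ, Module.Finite k (D.X i)) ∧
        Nonempty (HomotopyEquiv C D) ∧ ∀ i : ℤ, Projective (D.X i),
      ∃ D : ChainComplex (Rep.{u} k G) ℤ, BoucGeneralization.IsBounded D ∧
        (∀ i : ℤ, Module.Finite k (D.X i)) ∧
        Nonempty (HomotopyEquiv C D) ∧ ∀ i : ℤ, Projective (D.X i)] := by
  refine ⟨fun X _ h1 h2 h3 => BoucGeneralization.brauer_acyclic_tfae p C hC hCp ⟨h1, h2, h3⟩, ?_⟩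
  have h := BoucGeneralization.brauer_acyclic_tfae p C hC hCp
    (BoucGeneralization.isClosedFamily_bot p)
  -- Bouc's case is the family consisting of the trivial subgroup, for which relative projectivity
  -- is ordinary projectivity.
  have hproj : ∀ M : Rep.{u} k G, Module.Finite k M →
      (BoucGeneralization.IsSetProjective {⊥} M ↔ Projective M) := fun M _ =>
    BoucGeneralization.isSetProjective_iff.trans BoucGeneralization.projective_iff.symm
  tfae_have 1 → 3 := by
    intro h1
    obtain ⟨D, hD, hDp, e, hX⟩ := (h.out 0 2).mp h1
    exact ⟨D, hD, fun i => (hDp i).finite, e, fun i => (hproj _ (hDp i).finite).mp (hX i)⟩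
  tfae_have 3 → 2 := by
    rintro ⟨D, _, hfin, e, hX⟩
    exact ⟨D, hfin, e, hX⟩
  tfae_have 2 → 1 := by
    rintro ⟨D, hfin, e, hX⟩
    have h21 := h.out 1 0
    exact h21.mp ⟨D, hfin, e, fun i => (hproj _ (hfin i)).mpr (hX i)⟩
  tfae_finish
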